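/- Let $U$ be a unitary operator and $A$ a (possibly unbounded) self-adjoint operator with domain $\mathcal D(A)$ in a complex Hilbert space $\mathcal H$ (scalar product antilinear in the first argument). Assume that $U\in C^1(A)$, that is, for each $\varphi\in\mathcal H$ the map $\mathbb R\ni t\mapsto e^{-itA}Ue^{itA}\varphi\in\mathcal H$ is of class $C^1$, and let $[A,U]$ be the bounded operator associated with the (then bounded) form $(\varphi,\psi)\mapsto\langle A\varphi,U\psi\rangle-\langle\varphi,UA\psi\rangle$ on $\mathcal D(A)$. Assume that $[A,U]U^{-1}=g(U)$ for some $\gamma\in(0,1)$ and some $g\in C^{2+\gamma}(\mathbb S^1;\mathbb R)$, that is, $g:\mathbb S^1\to\mathbb R$ is such that $\theta\mapsto g(e^{i\theta})$ is of class $C^2$ on $\mathbb R$ with second derivative Hölder continuous of order $\gamma$. Set $\Theta:=\mathbb S^1\setminus g^{-1}(\{0\})$, and let $\chi_\Theta(U)$ be the spectral projection of $U$ on $\Theta$. Then the restriction of $U$ to the reducing subspace $\chi_\Theta(U)\mathcal H$ has purely absolutely continuous spectrum, that is, the spectral measure on $\mathbb S^1$ of each vector of $\chi_\Theta(U)\mathcal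 H$ with respect to this restriction is absolutely continuous with respect to the arc length measure. -/

import Mathlib

open MeasureTheory
open scoped InnerProductSpace

noncomputable section

namespace UnitarySpectral

instance instMeasurableSpaceCircle : MeasurableSpace Circle := borel Circle

instance instBorelSpaceCircle : BorelSpace Circle := ⟨rfl⟩

/-- The arc length measure on the unit circle (a Haar measure of total mass `2π`). -/
def arcLength : Measure Circle :=
  (volume.restrict (Set.Ioc (-Real.pi) Real.pi)).map Circle.exp

/-- The functions `g : S¹ → ℝ` of class `C^{k+γ}`: the periodic function `θ ↦ g (e^{iθ})`
on the line is of class `C^k`, and its `k`-th derivative is Hölder continuous of order `γ`. -/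
def IsHolderClass (k : ℕ) (γ : NNReal) (g : Circle → ℝ) : Prop :=
  ContDiff ℝ k (fun θ : ℝ => g (Circle.exp θ)) ∧
    ∃ K : NNReal, HolderWith K γ (iteratedDeriv k fun θ : ℝ => g (Circle.exp θ))

variable {H : Type*} [NormedAddCommGroup H] [InnerProductSpace ℂ H] [CompleteSpace H]

/-- The inclusion of the spectrum of a unitary operator in the unit circle. -/
def spectrumToCircle (U : unitary (H →L[ℂ] H)) : C(spectrum ℂ (U : H →L[ℂ] H), Circle) where
  toFun z := ⟨z.1, Unitary.spectrum_subset_circle U z.2⟩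
  continuous_toFun := Continuous.subtype_mk continuous_subtype_val _

/-- The continuous functional calculus `f ↦ f(U)` of a unitary operator `U`, for continuous
functions `f` on the unit circle. -/
def funCalc (U : unitary (H →L[ℂ] H)) : C(Circle, ℂ) →⋆ₐ[ℂ] (H →L[ℂ] H) :=
  (cfcHom (R := ℂ) (a := (U : H →L[ℂ] H)) (p := IsStarNormal) inferInstance).comp
    (ContinuousMap.compStarAlgHom' ℂ ℂ (spectrumToCircle U))

/-- A real valued continuous function, seen as a complex valued one. -/
def toComplex (g : C(Circle, ℝ)) : C(Circle, ℂ) where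
  toFun z := (g z : ℂ)
  continuous_toFun := Complex.continuous_ofReal.comp g.continuous

/-- The operator `g(U)`, for a real valued continuous function `g` on the unit circle. -/
def applyReal (U : unitary (H →L[ℂ] H)) (g : C(Circle, ℝ)) : H →L[ℂ] H :=
  funCalc U (toComplex g)

lemma funCalc_id (U : unitary (H →L[ℂ] H)) :
    funCalc U ⟨fun z => (z : ℂ), continuous_subtype_val⟩ = U := by
  have h := cfcHom_id (R := ℂ) (a := (U : H →L[ℂ] H)) (p := IsStarNormal) inferInstance
  rw [← h]
  rfl

lemma inner_applyReal_mul_self (U : unitary (H →L[ℂ] H)) (f : C(Circle, ℝ)) (φ : H) :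
    ⟪φ, applyReal U (f * f) φ⟫_ℂ = ⟪applyReal U f φ, applyReal U f φ⟫_ℂ := by
  have h1 : toComplex (f * f) = star (toComplex f) * toComplex f := by
    ext z; simp [toComplex]
  rw [applyReal, h1, map_mul, map_star, mul_apply_eq_comp,
    ContinuousLinearMap.star_eq_adjoint, ContinuousLinearMap.adjoint_inner_right]
  rfl

/-- The positive linear functional `f ↦ ⟨φ, f(U) φ⟩`. -/
def spectralFunctional (U : unitary (H →L[ℂ] H)) (φ : H) :
    CompactlySupportedContinuousMap Circle ℝ →ₚ[ℝ] ℝ :=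
  PositiveLinearMap.mk₀
    { toFun f := (⟪φ, applyReal U f.toContinuousMap φ⟫_ℂ).re
      map_add' f g := by
        have : toComplex (f + g).toContinuousMap
            = toComplex f.toContinuousMap + toComplex g.toContinuousMap := by
          ext z; simp [toComplex]
        simp [applyReal, this]
      map_smul' c f := by
        have : toComplex (c • f).toContinuousMap = (c : ℂ) • toComplex f.toContinuousMap := by
          ext z; simp [toComplex]
        rw [applyReal, this, map_smul, smul_apply, inner_smul_right,
          Complex.re_ofReal_mul]
        rfl }
    (fun f hf => by
      let h : C(Circle, ℝ) := ⟨fun z => Real.sqrt (f z), Real.continuous_sqrt.comp f.continuous⟩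
      have : f.toContinuousMap = h * h := by
        ext z
        exact (Real.mul_self_sqrt (hf z)).symm
      change 0 ≤ (⟪φ, applyReal U f.toContinuousMap φ⟫_ℂ).re
      rw [this, inner_applyReal_mul_self]
      exact inner_self_nonneg (𝕜 := ℂ))

/-- The spectral measure `S ↦ ⟨φ, χ_S(U) φ⟩` of a vector `φ` with respect to `U`: the Borel measure
on the circle with `∫ f dμ = ⟨φ, f(U) φ⟩` for all continuous `f`. -/
def spectralMeasure (U : unitary (H →L[ℂ] H)) (φ : H) : Measure Circle :=
  RealRMK.rieszMeasure (spectralFunctional U φ)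

instance (U : unitary (H →L[ℂ] H)) (φ : H) : (spectralMeasure U φ).Regular :=
  inferInstanceAs (RealRMK.rieszMeasure (spectralFunctional U φ)).Regular

instance (U : unitary (H →L[ℂ] H)) (φ : H) : IsFiniteMeasure (spectralMeasure U φ) :=
  ⟨isCompact_univ.measure_lt_top⟩

lemma integral_spectralMeasure (U : unitary (H →L[ℂ] H)) (φ : H) (f : C(Circle, ℝ)) :
    ∫ z, f z ∂(spectralMeasure U φ) = (⟪φ, applyReal U f φ⟫_ℂ).re :=
  RealRMK.integral_rieszMeasure (spectralFunctional U φ)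
    (CompactlySupportedContinuousMap.continuousMapEquiv f)

lemma measure_ext {μ ν : Measure Circle} [IsFiniteMeasure μ] [IsFiniteMeasure ν]
    (h : ∀ f : C(Circle, ℝ), ∫ z, f z ∂μ = ∫ z, f z ∂ν) : μ = ν :=
  ext_of_forall_integral_eq_of_IsFiniteMeasure fun f => h f.toContinuousMap

lemma integrable_circle {μ : Measure Circle} [IsFiniteMeasure μ] (f : C(Circle, ℝ)) :
    Integrable (fun z => f z) μ :=
  (BoundedContinuousFunction.mkOfCompact f).integrable μ

lemma spectralMeasure_add_sub (U : unitary (H →L[ℂ] H)) (φ ψ : H) :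
    spectralMeasure U (φ + ψ) + spectralMeasure U (φ - ψ)
      = (2 : NNReal) • (spectralMeasure U φ + spectralMeasure U ψ) := by
  refine measure_ext fun f => ?_
  rw [integral_add_measure (integrable_circle f) (integrable_circle f), integral_smul_nnreal_measure,
    integral_add_measure (integrable_circle f) (integrable_circle f)]
  simp only [integral_spectralMeasure, map_add, map_sub, inner_add_left, inner_add_right,
    inner_sub_left, inner_sub_right, Complex.add_re, Complex.sub_re, NNReal.smul_def]
  simp
  ring

lemma spectralMeasure_smul (U : unitary (H →L[ℂ] H)) (c : ℂ) (φ : H) :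
    spectralMeasure U (c • φ) = (‖c‖₊ ^ 2) • spectralMeasure U φ := by
  refine measure_ext fun f => ?_
  rw [integral_smul_nnreal_measure]
  rw [integral_spectralMeasure, integral_spectralMeasure, map_smul, inner_smul_left,
    inner_smul_right, ← mul_assoc, Complex.conj_mul', ← Complex.ofReal_pow, Complex.re_ofReal_mul]
  rfl

lemma spectralMeasure_add_le (U : unitary (H →L[ℂ] H)) (φ ψ : H) (S : Set Circle) :
    spectralMeasure U (φ + ψ) S ≤ 2 * (spectralMeasure U φ S + spectralMeasure U ψ S) := by
  have h := congrArg (fun μ : Measure Circle => μ S) (spectralMeasure_add_sub U φ ψ)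
  simp only [Measure.add_apply, Measure.smul_apply] at h
  calc _ ≤ _ := le_self_add
    _ = _ := h
    _ = _ := by rfl

lemma spectralMeasure_univ (U : unitary (H →L[ℂ] H)) (φ : H) :
    spectralMeasure U φ Set.univ = ENNReal.ofReal (‖φ‖ ^ 2) := by
  have h := integral_spectralMeasure U φ 1
  have h1 : toComplex 1 = 1 := by ext z; simp [toComplex]
  have h2 : (⟪φ, φ⟫_ℂ).re = ‖φ‖ ^ 2 := inner_self_eq_norm_sq (𝕜 := ℂ) φ
  rw [applyReal, h1, map_one, one_apply_eq_self, h2] at h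
  simp at h
  rw [← h, Measure.real, ENNReal.ofReal_toReal (measure_ne_top _ _)]

lemma spectralMeasure_apply_self (U : unitary (H →L[ℂ] H)) (φ : H) :
    spectralMeasure U ((U : H →L[ℂ] H) φ) = spectralMeasure U φ := by
  refine measure_ext fun f => ?_
  rw [integral_spectralMeasure, integral_spectralMeasure]
  have hc : applyReal U f * (U : H →L[ℂ] H) = (U : H →L[ℂ] H) * applyReal U f := by
    rw [applyReal, ← funCalc_id U, ← map_mul, ← map_mul, mul_comm]
  have h1 : applyReal U f ((U : H →L[ℂ] H) φ) = (U : H →L[ℂ] H) (applyReal U f φ) :=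
    congrArg (fun T : H →L[ℂ] H => T φ) hc
  rw [h1, ← ContinuousLinearMap.adjoint_inner_right, ← ContinuousLinearMap.star_eq_adjoint,
    ← mul_apply_eq_comp, Unitary.coe_star_mul_self]
  rfl

/-- The closed subspace `χ_S(U) H`: the vectors whose spectral measure is carried by `S`. It is the
range of the orthogonal projection `χ_S(U)`, see `spectralProjection`, `inner_spectralProjection`
and `range_spectralProjection`. -/
def spectralSubspace (U : unitary (H →L[ℂ] H)) (S : Set Circle) : Submodule ℂ H where
  carrier := {φ | spectralMeasure U φ Sᶜ = 0}
  add_mem' {φ ψ} hφ hψ := by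
    have h := spectralMeasure_add_le U φ ψ Sᶜ
    rw [Set.mem_ofPred_eq] at hφ hψ ⊢
    simpa [hφ, hψ] using h
  zero_mem' := by
    have h := spectralMeasure_univ U (0 : H)
    rw [norm_zero, zero_pow two_ne_zero, ENNReal.ofReal_zero] at h
    exact measure_mono_null (Set.subset_univ _) h
  smul_mem' c φ hφ := by
    rw [Set.mem_ofPred_eq] at hφ ⊢
    rw [spectralMeasure_smul, Measure.smul_apply, hφ, smul_zero]

lemma isClosed_spectralSubspace (U : unitary (H →L[ℂ] H)) (S : Set Circle) :
    IsClosed (spectralSubspace U S : Set H) := by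
  refine isClosed_of_closure_subset fun φ hφ => ?_
  change spectralMeasure U φ Sᶜ = 0
  refine le_antisymm (ENNReal.le_of_forall_pos_le_add fun ε hε _ => ?_) bot_le
  obtain ⟨ψ, hψ, hd⟩ := Metric.mem_closure_iff.1 hφ (Real.sqrt (ε / 2)) (by positivity)
  have hψ' : spectralMeasure U ψ Sᶜ = 0 := hψ
  have h := spectralMeasure_add_le U (φ - ψ) ψ Sᶜ
  rw [sub_add_cancel, hψ', add_zero] at h
  have h2 : spectralMeasure U (φ - ψ) Sᶜ ≤ ENNReal.ofReal (ε / 2) := by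
    refine (measure_mono (Set.subset_univ _)).trans ?_
    rw [spectralMeasure_univ]
    refine ENNReal.ofReal_le_ofReal ?_
    rw [← dist_eq_norm]
    exact ((Real.le_sqrt dist_nonneg (by positivity)).1 hd.le)
  rw [zero_add]
  calc _ ≤ _ := h
    _ ≤ 2 * ENNReal.ofReal (ε / 2) := by gcongr
    _ = ε := by
      rw [← ENNReal.ofReal_ofNat, ← ENNReal.ofReal_mul (by norm_num)]
      simp [mul_div_cancel₀]

instance (U : unitary (H →L[ℂ] H)) (S : Set Circle) : CompleteSpace (spectralSubspace U S) :=
  (isClosed_spectralSubspace U S).completeSpace_coe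

lemma enorm_applyReal (U : unitary (H →L[ℂ] H)) (φ : H) (f : C(Circle, ℝ)) :
    ‖applyReal U f φ‖ₑ = eLpNorm (fun z => f z) 2 (spectralMeasure U φ) := by
  have h := integral_spectralMeasure U φ (f * f)
  rw [inner_applyReal_mul_self] at h
  have h2 : (⟪applyReal U f φ, applyReal U f φ⟫_ℂ).re = ‖applyReal U f φ‖ ^ 2 :=
    inner_self_eq_norm_sq (𝕜 := ℂ) _
  have hm : MemLp (fun z => f z) 2 (spectralMeasure U φ) :=
    (BoundedContinuousFunction.mkOfCompact f).memLp_top.mono_exponent le_top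
  rw [hm.eLpNorm_eq_integral_rpow_norm two_ne_zero ENNReal.ofNat_ne_top]
  simp only [ENNReal.toReal_ofNat, Real.rpow_ofNat, Real.norm_eq_abs, sq_abs]
  rw [h2] at h
  have h3 : ∫ z, f z ^ 2 ∂(spectralMeasure U φ) = ‖applyReal U f φ‖ ^ 2 := by
    rw [← h]
    simp [pow_two]
  rw [h3, ← one_div, ← Real.sqrt_eq_rpow, Real.sqrt_sq (norm_nonneg _), ofReal_norm]

lemma applyReal_mul (U : unitary (H →L[ℂ] H)) (f g : C(Circle, ℝ)) :
    applyReal U (f * g) = applyReal U f * applyReal U g := by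
  have : toComplex (f * g) = toComplex f * toComplex g := by ext z; simp [toComplex]
  rw [applyReal, this, map_mul]
  rfl

lemma applyReal_sub (U : unitary (H →L[ℂ] H)) (f g : C(Circle, ℝ)) :
    applyReal U (f - g) = applyReal U f - applyReal U g := by
  have : toComplex (f - g) = toComplex f - toComplex g := by ext z; simp [toComplex]
  rw [applyReal, this, map_sub]
  rfl

lemma applyReal_one (U : unitary (H →L[ℂ] H)) : applyReal U 1 = 1 := by
  have : toComplex 1 = 1 := by ext z; simp [toComplex]
  rw [applyReal, this, map_one]

lemma inner_applyReal_left (U : unitary (H →L[ℂ] H)) (f : C(Circle, ℝ)) (φ ψ : H) :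
    ⟪applyReal U f φ, ψ⟫_ℂ = ⟪φ, applyReal U f ψ⟫_ℂ := by
  have h1 : star (toComplex f) = toComplex f := by
    ext z; simp [toComplex]
  have h2 : star (applyReal U f) = applyReal U f := by
    rw [applyReal, ← map_star, h1]
  rw [← ContinuousLinearMap.adjoint_inner_right, ← ContinuousLinearMap.star_eq_adjoint, h2]

lemma spectralMeasure_applyReal (U : unitary (H →L[ℂ] H)) (φ : H) (f : C(Circle, ℝ)) :
    spectralMeasure U (applyReal U f φ)
      = (spectralMeasure U φ).withDensity fun z => ((‖f z‖₊ ^ 2 : NNReal) : ENNReal) := by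
  have hc : Continuous fun z => ‖f z‖₊ ^ 2 := by fun_prop
  have hfin : IsFiniteMeasure
      ((spectralMeasure U φ).withDensity fun z => ((‖f z‖₊ ^ 2 : NNReal) : ENNReal)) := by
    refine isFiniteMeasure_withDensity ?_
    obtain ⟨C, hC⟩ := isCompact_univ.bddAbove_image hc.continuousOn
    refine ((lintegral_mono (g := fun _ => (C : ENNReal)) fun z => ?_).trans_lt ?_).ne
    · exact ENNReal.coe_le_coe.2 (hC ⟨z, trivial, rfl⟩)
    · rw [lintegral_const]
      exact ENNReal.mul_lt_top ENNReal.coe_lt_top (measure_lt_top _ _)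
  refine measure_ext fun g => ?_
  rw [integral_withDensity_eq_integral_smul hc.measurable, integral_spectralMeasure,
    inner_applyReal_left, ← mul_apply_eq_comp, ← mul_apply_eq_comp, ← applyReal_mul,
    ← applyReal_mul, ← integral_spectralMeasure]
  refine integral_congr_ae (Filter.Eventually.of_forall fun z => ?_)
  simp only [ContinuousMap.mul_apply, NNReal.smul_def, NNReal.coe_pow, coe_nnnorm,
    Real.norm_eq_abs, sq_abs, smul_eq_mul]
  ring

lemma spectralMeasure_applyReal_compl_le (U : unitary (H →L[ℂ] H)) (φ : H) (f : C(Circle, ℝ))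
    {S : Set Circle} (hS : MeasurableSet S) :
    spectralMeasure U (applyReal U f φ) Sᶜ
      ≤ eLpNorm (S.indicator 1 - fun z => f z) 2 (spectralMeasure U φ) ^ 2 := by
  rw [spectralMeasure_applyReal, withDensity_apply _ hS.compl,
    eLpNorm_eq_lintegral_rpow_enorm_toReal two_ne_zero ENNReal.ofNat_ne_top,
    ← ENNReal.rpow_natCast, ← ENNReal.rpow_mul]
  simp only [ENNReal.toReal_ofNat, Nat.cast_ofNat, one_div, ne_eq, OfNat.ofNat_ne_zero,
    not_false_eq_true, inv_mul_cancel₀, ENNReal.rpow_one]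
  refine le_trans (le_of_eq (setLIntegral_congr_fun hS.compl fun z hz => ?_))
    (setLIntegral_le_lintegral Sᶜ _)
  have hz' : z ∉ S := hz
  simp [hz', enorm_eq_nnnorm]

lemma inner_eq_zero_of_spectralMeasure (U : unitary (H →L[ℂ] H)) {S : Set Circle}
    (hS : MeasurableSet S) {φ ψ : H} (hφ : spectralMeasure U φ Sᶜ = 0)
    (hψ : spectralMeasure U ψ S = 0) : ⟪φ, ψ⟫_ℂ = 0 := by
  have key : ∀ ε : NNReal, 0 < ε → ‖⟪φ, ψ⟫_ℂ‖ ≤ ε * (‖φ‖ + ‖ψ‖) := by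
    intro ε hε
    have hm : MemLp (S.indicator (1 : Circle → ℝ)) 2 (spectralMeasure U φ + spectralMeasure U ψ) :=
      (memLp_const (1 : ℝ)).indicator hS
    obtain ⟨f, hf, -⟩ := hm.exists_boundedContinuous_eLpNorm_sub_le ENNReal.ofNat_ne_top
      (ε := ε) (by exact_mod_cast hε.ne')
    have h1 : ‖φ - applyReal U f.toContinuousMap φ‖ ≤ ε := by
      have e : φ - applyReal U f.toContinuousMap φ = applyReal U (1 - f.toContinuousMap) φ := by
        rw [applyReal_sub, applyReal_one]; rfl
      refine ENNReal.coe_le_coe.1 (?_ : ‖φ - applyReal U f.toContinuousMap φ‖ₑ ≤ ε)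
      rw [e, enorm_applyReal]
      refine le_trans (le_of_eq (eLpNorm_congr_ae ?_))
        ((eLpNorm_mono_measure _ (Measure.le_add_right le_rfl)).trans hf)
      filter_upwards [compl_mem_ae_iff.2 hφ] with z hz
      have hz' : z ∈ S := by simpa using hz
      simp [hz']
    have h2 : ‖applyReal U f.toContinuousMap ψ‖ ≤ ε := by
      refine ENNReal.coe_le_coe.1 (?_ : ‖applyReal U f.toContinuousMap ψ‖ₑ ≤ ε)
      rw [enorm_applyReal, ← eLpNorm_neg]
      refine le_trans (le_of_eq (eLpNorm_congr_ae ?_))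
        ((eLpNorm_mono_measure _ (Measure.le_add_left le_rfl)).trans hf)
      filter_upwards [compl_mem_ae_iff.2 hψ] with z hz
      have hz' : z ∉ S := by simpa using hz
      simp [hz']
    have h3 : ⟪φ, ψ⟫_ℂ = ⟪φ - applyReal U f.toContinuousMap φ, ψ⟫_ℂ
        + ⟪φ, applyReal U f.toContinuousMap ψ⟫_ℂ := by
      rw [inner_sub_left, inner_applyReal_left]; ring
    rw [h3]
    calc _ ≤ _ := norm_add_le _ _
      _ ≤ ‖φ - applyReal U f.toContinuousMap φ‖ * ‖ψ‖ + ‖φ‖ * ‖applyReal U f.toContinuousMap ψ‖ :=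
        add_le_add (norm_inner_le_norm _ _) (norm_inner_le_norm _ _)
      _ ≤ ε * ‖ψ‖ + ‖φ‖ * ε := by gcongr
      _ = _ := by ring
  have hlim : Filter.Tendsto (fun ε : NNReal => (ε : ℝ) * (‖φ‖ + ‖ψ‖))
      (nhdsWithin 0 (Set.Ioi 0)) (nhds 0) := by
    have : Filter.Tendsto (fun ε : NNReal => (ε : ℝ) * (‖φ‖ + ‖ψ‖)) (nhds 0) (nhds 0) := by
      have hc : Continuous fun ε : NNReal => (ε : ℝ) * (‖φ‖ + ‖ψ‖) := by fun_prop
      simpa using hc.tendsto 0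
    exact this.mono_left nhdsWithin_le_nhds
  refine norm_le_zero_iff.1 (ge_of_tendsto hlim ?_)
  filter_upwards [self_mem_nhdsWithin] with ε hε using key ε hε

lemma mem_spectralSubspace_of_tendsto (U : unitary (H →L[ℂ] H)) {S : Set Circle}
    (hS : MeasurableSet S) {φ a : H} {f : ℕ → C(Circle, ℝ)}
    (hf : Filter.Tendsto (fun n => eLpNorm (S.indicator 1 - fun z => f n z) 2
      (spectralMeasure U φ)) Filter.atTop (nhds 0))
    (ha : Filter.Tendsto (fun n => applyReal U (f n) φ) Filter.atTop (nhds a)) :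
    spectralMeasure U a Sᶜ = 0 := by
  have h1 : ∀ n, spectralMeasure U a Sᶜ ≤ 2 * (ENNReal.ofReal (‖a - applyReal U (f n) φ‖ ^ 2)
      + eLpNorm (S.indicator 1 - fun z => f n z) 2 (spectralMeasure U φ) ^ 2) := by
    intro n
    have h := spectralMeasure_add_le U (a - applyReal U (f n) φ) (applyReal U (f n) φ) Sᶜ
    rw [sub_add_cancel] at h
    refine h.trans ?_
    gcongr
    · rw [← spectralMeasure_univ U]
      exact measure_mono (Set.subset_univ _)
    · exact spectralMeasure_applyReal_compl_le U φ (f n) hS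
  refine le_antisymm (ge_of_tendsto' (x := Filter.atTop) ?_ h1) bot_le
  have h2 : Filter.Tendsto (fun n => ENNReal.ofReal (‖a - applyReal U (f n) φ‖ ^ 2))
      Filter.atTop (nhds 0) := by
    have : Filter.Tendsto (fun n => ‖a - applyReal U (f n) φ‖ ^ 2) Filter.atTop (nhds 0) := by
      simpa using ((tendsto_const_nhds (x := a)).sub ha).norm.pow 2
    simpa using ENNReal.tendsto_ofReal this
  have h3 := h2.add (ENNReal.Tendsto.pow (n := 2) hf)
  simpa using ENNReal.Tendsto.const_mul h3 (Or.inr ENNReal.ofNat_ne_top) (a := 2)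

/-- The spectral projection `χ_S(U)`. -/
def spectralProjection (U : unitary (H →L[ℂ] H)) (S : Set Circle) : H →L[ℂ] H :=
  (spectralSubspace U S).starProjection

/-- `⟨φ, χ_S(U) φ⟩ = μ_φ(S)` for all Borel sets `S` and all vectors `φ`, where `μ_φ` is the spectral
measure of `φ`. -/
theorem inner_spectralProjection (U : unitary (H →L[ℂ] H)) {S : Set Circle}
    (hS : MeasurableSet S) (φ : H) :
    ⟪φ, spectralProjection U S φ⟫_ℂ = ((spectralMeasure U φ).real S : ℂ) := by
  have hm : MemLp (S.indicator (1 : Circle → ℝ)) 2 (spectralMeasure U φ) :=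
    (memLp_const (1 : ℝ)).indicator hS
  have hex : ∀ n : ℕ, ∃ f : C(Circle, ℝ),
      eLpNorm (S.indicator 1 - fun z => f z) 2 (spectralMeasure U φ) ≤ ((n : ENNReal) + 1)⁻¹ := by
    intro n
    obtain ⟨f, hf, -⟩ := hm.exists_boundedContinuous_eLpNorm_sub_le ENNReal.ofNat_ne_top
      (ε := ((n : ENNReal) + 1)⁻¹) (by simp)
    exact ⟨f.toContinuousMap, hf⟩
  choose f hf using hex
  have hε : Filter.Tendsto (fun n : ℕ => ((n : ENNReal) + 1)⁻¹) Filter.atTop (nhds 0) := by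
    have h := ENNReal.tendsto_inv_nat_nhds_zero.comp (Filter.tendsto_add_atTop_nat 1)
    refine h.congr fun n => ?_
    simp
  have hf0 := tendsto_of_tendsto_of_tendsto_of_le_of_le tendsto_const_nhds hε
    (fun n => zero_le) hf
  have hmeas : ∀ g : C(Circle, ℝ),
      AEStronglyMeasurable (fun z => g z) (spectralMeasure U φ) :=
    fun g => g.continuous.aestronglyMeasurable
  have hmi : AEStronglyMeasurable (S.indicator (1 : Circle → ℝ)) (spectralMeasure U φ) := hm.1
  have hcau : CauchySeq fun n => applyReal U (f n) φ := by
    refine EMetric.cauchySeq_iff_le_tendsto_0.2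
      ⟨fun n => 2 * ((n : ENNReal) + 1)⁻¹, fun n m N hn hM => ?_, ?_⟩
    · rw [edist_eq_enorm_sub, ← sub_apply, ← applyReal_sub, enorm_applyReal]
      have e : (fun z => (f n - f m) z) = (S.indicator 1 - fun z => f m z)
          - (S.indicator 1 - fun z => f n z) := by
        ext z; simp
      change _ ≤ 2 * ((N : ENNReal) + 1)⁻¹
      rw [e, two_mul]
      refine (eLpNorm_sub_le (hmi.sub (hmeas _)) (hmi.sub (hmeas _)) one_le_two).trans ?_
      refine add_le_add ((hf m).trans ?_) ((hf n).trans ?_) <;> gcongr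
    · simpa using ENNReal.Tendsto.const_mul hε (Or.inr ENNReal.ofNat_ne_top) (a := 2)
  obtain ⟨a, ha⟩ := cauchySeq_tendsto_of_complete hcau
  have hP : spectralProjection U S φ = a := by
    refine Submodule.eq_starProjection_of_mem_orthogonal
      (mem_spectralSubspace_of_tendsto U hS hf0 ha) ?_
    rw [Submodule.mem_orthogonal]
    intro c hc
    refine inner_eq_zero_of_spectralMeasure U hS hc ?_
    rw [← compl_compl S]
    refine mem_spectralSubspace_of_tendsto U hS.compl (φ := φ) (f := fun n => 1 - f n) ?_ ?_
    · refine hf0.congr fun n => ?_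
      rw [← eLpNorm_neg]
      congr 1
      ext z
      by_cases hz : z ∈ S <;> simp [hz]
    · refine ((tendsto_const_nhds (x := φ)).sub ha).congr fun n => ?_
      rw [applyReal_sub, applyReal_one]
      rfl
  have hn : ‖a‖ₑ = eLpNorm (S.indicator (1 : Circle → ℝ)) 2 (spectralMeasure U φ) := by
    have hl := ha.enorm
    refine le_antisymm ?_ ?_
    · have h2 := (tendsto_const_nhds
        (x := eLpNorm (S.indicator (1 : Circle → ℝ)) 2 (spectralMeasure U φ))).add hε
      rw [add_zero] at h2
      refine le_of_tendsto_of_tendsto' hl h2 fun n => ?_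
      rw [enorm_applyReal]
      have e : (fun z => f n z) = S.indicator 1 - (S.indicator 1 - fun z => f n z) := by
        ext z; simp
      conv_lhs => rw [e]
      exact (eLpNorm_sub_le hmi (hmi.sub (hmeas _)) one_le_two).trans (by gcongr; exact hf n)
    · have h2 := hl.add hε
      rw [add_zero] at h2
      refine ge_of_tendsto' h2 fun n => ?_
      rw [enorm_applyReal]
      have e : S.indicator (1 : Circle → ℝ) = (fun z => f n z)
          + (S.indicator 1 - fun z => f n z) := by
        ext z; simp
      conv_lhs => rw [e]
      exact (eLpNorm_add_le (hmeas _) (hmi.sub (hmeas _)) one_le_two).trans (by gcongr; exact hf n)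
  have hn2 : ‖a‖ ^ 2 = (spectralMeasure U φ).real S := by
    have e : S.indicator (1 : Circle → ℝ) = S.indicator fun _ => (1 : ℝ) := rfl
    rw [e, eLpNorm_indicator_const hS two_ne_zero ENNReal.ofNat_ne_top] at hn
    have h := congrArg (fun x => (x ^ 2).toReal) hn
    simp only [enorm_one, one_mul, ← ENNReal.rpow_natCast, ← ENNReal.rpow_mul] at h
    simpa [Measure.real] using h
  have hin : ⟪φ, a⟫_ℂ = ⟪a, a⟫_ℂ := by
    have h := Submodule.starProjection_inner_eq_zero (K := spectralSubspace U S) φ a (by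
      rw [← hP]; exact Submodule.starProjection_apply_mem _ _)
    change ⟪φ - spectralProjection U S φ, a⟫_ℂ = 0 at h
    rw [hP, inner_sub_left, sub_eq_zero] at h
    exact h
  rw [hP, hin, inner_self_eq_norm_sq_to_K, ← hn2]
  norm_cast

theorem range_spectralProjection (U : unitary (H →L[ℂ] H)) (S : Set Circle) :
    (spectralProjection U S).range = spectralSubspace U S :=
  Submodule.range_starProjection _

/-- The restriction of a unitary operator `U` to a closed subspace `K` that reduces it. -/
def restrict (U : unitary (H →L[ℂ] H)) (K : Submodule ℂ H) [CompleteSpace K]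
    (h : ∀ φ ∈ K, (U : H →L[ℂ] H) φ ∈ K)
    (h' : ∀ φ ∈ K, (star U : H →L[ℂ] H) φ ∈ K) : unitary (K →L[ℂ] K) :=
  let T : K →L[ℂ] K := ((U : H →L[ℂ] H).comp K.subtypeL).codRestrict K fun φ => h φ φ.2
  let T' : K →L[ℂ] K := ((star U : H →L[ℂ] H).comp K.subtypeL).codRestrict K fun φ => h' φ φ.2
  have e : star T = T' := by
    rw [ContinuousLinearMap.star_eq_adjoint]
    refine ((ContinuousLinearMap.eq_adjoint_iff T' T).2 fun x y => ?_).symm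
    change ⟪(star U : H →L[ℂ] H) x, (y : H)⟫_ℂ = ⟪(x : H), (U : H →L[ℂ] H) y⟫_ℂ
    rw [ContinuousLinearMap.star_eq_adjoint, ContinuousLinearMap.adjoint_inner_left]
  ⟨T, by
    rw [Unitary.mem_iff, e]
    constructor <;> ext φ
    · exact congrArg (fun S : H →L[ℂ] H => S φ) (Unitary.coe_star_mul_self U)
    · exact congrArg (fun S : H →L[ℂ] H => S φ) (Unitary.coe_mul_star_self U)⟩

lemma map_mem_spectralSubspace (U : unitary (H →L[ℂ] H)) (S : Set Circle) :
    ∀ φ ∈ spectralSubspace U S, (U : H →L[ℂ] H) φ ∈ spectralSubspace U S := by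
  intro φ hφ
  change spectralMeasure U ((U : H →L[ℂ] H) φ) Sᶜ = 0
  rw [spectralMeasure_apply_self]
  exact hφ

lemma star_map_mem_spectralSubspace (U : unitary (H →L[ℂ] H)) (S : Set Circle) :
    ∀ φ ∈ spectralSubspace U S, (star U : H →L[ℂ] H) φ ∈ spectralSubspace U S := by
  intro φ hφ
  change spectralMeasure U ((star U : H →L[ℂ] H) φ) Sᶜ = 0
  rw [← spectralMeasure_apply_self]
  have : (U : H →L[ℂ] H) ((star U : H →L[ℂ] H) φ) = φ :=
    congrArg (fun S : H →L[ℂ] H => S φ) (Unitary.coe_mul_star_self U)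
  rw [this]
  exact hφ

/-- The unitary operator `U|_{χ_S(U) H}` in the Hilbert space `χ_S(U) H`. -/
def spectralRestriction (U : unitary (H →L[ℂ] H)) (S : Set Circle) :
    unitary (spectralSubspace U S →L[ℂ] spectralSubspace U S) :=
  restrict U (spectralSubspace U S) (map_mem_spectralSubspace U S)
    (star_map_mem_spectralSubspace U S)

/-- A unitary operator has purely absolutely continuous spectrum if all its spectral measures are
absolutely continuous with respect to the arc length measure. -/
def HasPurelyACSpectrum (U : unitary (H →L[ℂ] H)) : Prop :=
  ∀ φ : H, spectralMeasure U φ ≪ arcLength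

/-- `V` is the strongly continuous one-parameter unitary group `t ↦ e^{itA}` with generator `A`:
the orbit of `φ` is differentiable at `0` precisely if `φ` belongs to the domain of `A`, and then
its derivative at `0` is `i A φ`. -/
structure IsUnitaryGroup (A : H →ₗ.[ℂ] H) (V : ℝ → unitary (H →L[ℂ] H)) : Prop where
  map_add : ∀ s t, V (s + t) = V s * V t
  continuous : ∀ φ : H, Continuous fun t => (V t : H →L[ℂ] H) φ
  generator : ∀ φ ψ : H,
    HasDerivAt (fun t => (V t : H →L[ℂ] H) φ) (Complex.I • ψ) 0 ↔ (φ, ψ) ∈ A.graph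

section Stone

variable {A : H →ₗ.[ℂ] H}

lemma graph_symm (hA : IsSelfAdjoint A) {x w y v : H} (h : (x, w) ∈ A.graph)
    (h' : (y, v) ∈ A.graph) : ⟪w, y⟫_ℂ = ⟪x, v⟫_ℂ := by
  obtain ⟨x', rfl, rfl⟩ := (LinearPMap.mem_graph_iff A).1 h
  obtain ⟨y', rfl, rfl⟩ := (LinearPMap.mem_graph_iff A).1 h'
  have h1 := LinearPMap.adjoint_isFormalAdjoint (T := A) hA.dense_domain
  rw [LinearPMap.isSelfAdjoint_def.1 hA] at h1
  exact h1 x' y'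

lemma mem_graph_of_forall (hA : IsSelfAdjoint A) {y v : H}
    (h : ∀ x w, (x, w) ∈ A.graph → ⟪v, x⟫_ℂ = ⟪y, w⟫_ℂ) : (y, v) ∈ A.graph := by
  have h1 : ∀ x : A.domain, ⟪v, (x : H)⟫_ℂ = ⟪y, A x⟫_ℂ := fun x => h _ _ (A.mem_graph x)
  have h2 := LinearPMap.mem_adjoint_domain_of_exists (T := A) y ⟨v, h1⟩
  have h3 := LinearPMap.adjoint_apply_eq (T := A) hA.dense_domain ⟨y, h2⟩ h1
  have h4 : (y, v) ∈ A.adjoint.graph := h3 ▸ LinearPMap.mem_graph (A.adjoint) ⟨y, h2⟩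
  rwa [LinearPMap.isSelfAdjoint_def.1 hA] at h4

lemma norm_sq_graph (hA : IsSelfAdjoint A) (s : ℝ) {x w : H} (h : (x, w) ∈ A.graph) :
    ‖x + (Complex.I * s) • w‖ ^ 2 = ‖x‖ ^ 2 + s ^ 2 * ‖w‖ ^ 2 := by
  have h1 : (⟪x, w⟫_ℂ).im = 0 := by
    have := graph_symm hA h h
    rw [← inner_conj_symm] at this
    have := congrArg Complex.im this
    simp only [Complex.conj_im] at this
    linarith
  rw [norm_add_sq (𝕜 := ℂ), inner_smul_right, norm_smul, mul_pow]
  simp [h1]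

lemma exists_resolvent_apply (hA : IsSelfAdjoint A) {s : ℝ} (hs : s ≠ 0) (y : H) :
    ∃ p : H × H, p ∈ A.graph ∧ p.1 + (Complex.I * s) • p.2 = y := by
  let L : H × H →L[ℂ] H :=
    ContinuousLinearMap.fst ℂ H H + (Complex.I * s : ℂ) • ContinuousLinearMap.snd ℂ H H
  have hLa : ∀ p : H × H, L p = p.1 + (Complex.I * s) • p.2 := fun p => rfl
  have hc : IsClosed (A.graph : Set (H × H)) := hA.isClosed
  let M : Submodule ℂ H := A.graph.map (L : H × H →ₗ[ℂ] H)
  have hM : IsClosed (M : Set H) := by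
    have : CompleteSpace A.graph := hc.completeSpace_coe
    let L' : A.graph →L[ℂ] H := L.comp A.graph.subtypeL
    have hanti : AntilipschitzWith (Real.toNNReal (max 1 |s|⁻¹)) L' := by
      refine ContinuousLinearMap.antilipschitz_of_bound _ fun p => ?_
      have h1 := norm_sq_graph hA s p.2
      have h2 : ‖L' p‖ = ‖(p : H × H).1 + (Complex.I * s) • (p : H × H).2‖ := rfl
      rw [← h2] at h1
      have hmax : (0 : ℝ) ≤ max 1 |s|⁻¹ := le_trans zero_le_one (le_max_left _ _)
      rw [Real.coe_toNNReal _ hmax]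
      change max ‖(p : H × H).1‖ ‖(p : H × H).2‖ ≤ _
      have hp : (0 : ℝ) < |s| := abs_pos.2 hs
      refine max_le ?_ ?_
      · have : ‖(p : H × H).1‖ ≤ ‖L' p‖ := by
          refine le_of_sq_le_sq ?_ (norm_nonneg _)
          rw [h1]
          have := mul_nonneg (sq_nonneg s) (sq_nonneg ‖(p : H × H).2‖)
          linarith
        calc _ ≤ _ := this
          _ = 1 * ‖L' p‖ := (one_mul _).symm
          _ ≤ _ := by gcongr; exact le_max_left _ _
      · have : |s| * ‖(p : H × H).2‖ ≤ ‖L' p‖ := by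
          refine le_of_sq_le_sq ?_ (norm_nonneg _)
          rw [h1, mul_pow, sq_abs]
          have := sq_nonneg ‖(p : H × H).1‖
          linarith
        calc _ ≤ |s|⁻¹ * ‖L' p‖ := by rw [inv_mul_eq_div, le_div_iff₀ hp]; linarith
          _ ≤ _ := by gcongr; exact le_max_right _ _
    have hr := hanti.isClosed_range L'.uniformContinuous
    convert hr using 1
    ext z
    simp only [M, L', Submodule.map_coe, Set.mem_image, Set.mem_range]
    constructor
    · rintro ⟨p, hp, rfl⟩
      exact ⟨⟨p, hp⟩, rfl⟩
    · rintro ⟨p, rfl⟩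
      exact ⟨p, p.2, rfl⟩
  have hperp : Mᗮ = ⊥ := by
    refine (Submodule.eq_bot_iff _).2 fun z hz => ?_
    have hz' : ∀ x w, (x, w) ∈ A.graph → ⟪z, x + (Complex.I * s) • w⟫_ℂ = 0 := fun x w h =>
      (Submodule.mem_orthogonal' _ _).1 hz _ ⟨(x, w), h, rfl⟩
    have hs' : (s : ℂ) ≠ 0 := by exact_mod_cast hs
    have hg : (z, (-Complex.I / s) • z) ∈ A.graph := by
      refine mem_graph_of_forall hA fun x w h => ?_
      have h1 := hz' x w h
      rw [inner_add_right, inner_smul_right] at h1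
      rw [inner_smul_left, eq_neg_of_add_eq_zero_left h1]
      simp only [map_div₀, map_neg, Complex.conj_I, Complex.conj_ofReal]
      field_simp
      ring_nf
      simp
    have h1 := norm_sq_graph hA (-s) hg
    have h2 : z + (Complex.I * ((-s : ℝ) : ℂ)) • ((-Complex.I / s) • z) = 0 := by
      rw [smul_smul]
      have : (Complex.I * ((-s : ℝ) : ℂ)) * (-Complex.I / s) = -1 := by
        push_cast
        field_simp
        simp
      rw [this]
      simp
    rw [h2] at h1
    have h3 := mul_nonneg (sq_nonneg (-s)) (sq_nonneg ‖(-Complex.I / s) • z‖)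
    have h4 : ‖z‖ ^ 2 = 0 := by
      have := sq_nonneg ‖z‖
      simp only [norm_zero] at h1
      linarith [zero_pow (M₀ := ℝ) two_ne_zero]
    simpa using h4
  have : CompleteSpace M := hM.completeSpace_coe
  have htop : M = ⊤ := Submodule.orthogonal_eq_bot_iff.1 hperp
  have hy : y ∈ M := htop ▸ Submodule.mem_top
  obtain ⟨p, hp, hpy⟩ := hy
  exact ⟨p, hp, hpy⟩

lemma resolvent_unique (hA : IsSelfAdjoint A) {s : ℝ} {x w x' w' : H} (h : (x, w) ∈ A.graph)
    (h' : (x', w') ∈ A.graph) (e : x + (Complex.I * s) • w = x' + (Complex.I * s) • w') :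
    x = x' := by
  have h1 : (x - x', w - w') ∈ A.graph := A.graph.sub_mem h h'
  have h2 := norm_sq_graph hA s h1
  have h3 : x - x' + (Complex.I * s) • (w - w') = 0 := by
    rw [smul_sub, ← sub_eq_zero.2 e]; abel
  rw [h3] at h2
  have h4 := mul_nonneg (sq_nonneg s) (sq_nonneg ‖w - w'‖)
  have h5 : ‖x - x'‖ ^ 2 = 0 := by
    have := sq_nonneg ‖x - x'‖
    simp only [norm_zero] at h2
    linarith [zero_pow (M₀ := ℝ) two_ne_zero]
  exact sub_eq_zero.1 (by simpa using h5)

/-- The operators `(1 + isA)⁻¹`. -/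
lemma exists_resolvent (hA : IsSelfAdjoint A) {s : ℝ} (hs : s ≠ 0) :
    ∃ J : H →L[ℂ] H, (∀ φ, ‖J φ‖ ≤ ‖φ‖) ∧
      ∀ φ, ∃ w, (J φ, w) ∈ A.graph ∧ J φ + (Complex.I * s) • w = φ := by
  choose p hp hpy using exists_resolvent_apply hA hs
  have hadd : ∀ x y, (p (x + y)).1 = (p x).1 + (p y).1 := fun x y => by
    refine resolvent_unique hA (s := s) (w := (p (x + y)).2) (w' := (p x).2 + (p y).2) (hp _)
      (A.graph.add_mem (hp x) (hp y)) ?_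
    rw [hpy]
    nth_rewrite 1 [← hpy x, ← hpy y]
    rw [smul_add]
    abel
  have hsmul : ∀ (c : ℂ) x, (p (c • x)).1 = c • (p x).1 := fun c x => by
    refine resolvent_unique hA (s := s) (w := (p (c • x)).2) (w' := c • (p x).2) (hp _)
      (A.graph.smul_mem c (hp x)) ?_
    rw [hpy]
    nth_rewrite 1 [← hpy x]
    rw [smul_add, smul_comm]
  have hnorm : ∀ x, ‖(p x).1‖ ≤ ‖x‖ := fun x => by
    have h := norm_sq_graph hA s (hp x)
    change ‖(p x).1 + (Complex.I * s) • (p x).2‖ ^ 2 = _ at h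
    rw [hpy] at h
    refine le_of_sq_le_sq ?_ (norm_nonneg _)
    rw [h]
    have := mul_nonneg (sq_nonneg s) (sq_nonneg ‖(p x).2‖)
    linarith
  exact ⟨LinearMap.mkContinuous ⟨⟨fun x => (p x).1, hadd⟩, hsmul⟩ 1
    fun x => by simpa using hnorm x, hnorm, fun φ => ⟨(p φ).2, hp φ, hpy φ⟩⟩

/-- Bounded self-adjoint commuting operators that approximate `A`. -/
lemma exists_approx (hA : IsSelfAdjoint A) :
    ∃ B : ℕ → (H →L[ℂ] H), (∀ n, star (B n) = B n) ∧ (∀ m n, B m * B n = B n * B m) ∧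
      ∀ φ ψ, (φ, ψ) ∈ A.graph → Filter.Tendsto (fun n => B n φ) Filter.atTop (nhds ψ) := by
  have hJ' : ∀ s : ℝ, ∃ J : H →L[ℂ] H, s ≠ 0 → ((∀ φ, ‖J φ‖ ≤ ‖φ‖) ∧
      ∀ φ, ∃ w, (J φ, w) ∈ A.graph ∧ J φ + (Complex.I * s) • w = φ) := fun s => by
    by_cases hs : s = 0
    · exact ⟨0, fun h => absurd hs h⟩
    · obtain ⟨J, hJ⟩ := exists_resolvent hA hs
      exact ⟨J, fun _ => hJ⟩
  choose J hJ using hJ'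
  have eqJ : ∀ s : ℝ, s ≠ 0 → ∀ x w φ, (x, w) ∈ A.graph → x + (Complex.I * s) • w = φ →
      J s φ = x := by
    intro s hs x w φ h e
    obtain ⟨w', h', e'⟩ := (hJ s hs).2 φ
    exact resolvent_unique hA h' h (e'.trans e.symm)
  have hgraph : ∀ s : ℝ, s ≠ 0 → ∀ x w, (x, w) ∈ A.graph →
      (J s x, J s w) ∈ A.graph ∧ J s x + (Complex.I * s) • J s w = x := by
    intro s hs x w h
    obtain ⟨v, hv, ev⟩ := (hJ s hs).2 x
    have hc : (Complex.I * s : ℂ) ≠ 0 := by simp [hs]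
    have hv' : v = (Complex.I * s)⁻¹ • (x - J s x) := by
      rw [eq_inv_smul_iff₀ hc]
      exact eq_sub_of_add_eq' ev
    have h1 : (v, (Complex.I * s)⁻¹ • (w - v)) ∈ A.graph := by
      have := A.graph.smul_mem (Complex.I * s)⁻¹ (A.graph.sub_mem h hv)
      rw [hv']
      rw [hv'] at this
      exact this
    have h2 : J s w = v := by
      refine eqJ s hs _ _ _ h1 ?_
      rw [smul_inv_smul₀ hc]
      abel
    rw [h2]
    exact ⟨hv, ev⟩
  have hcomm : ∀ s t : ℝ, s ≠ 0 → t ≠ 0 → J s * J t = J t * J s := by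
    intro s t hs ht
    ext y
    obtain ⟨w, hw, e⟩ := (hJ t ht).2 y
    have h1 := (hgraph s hs _ _ hw).1
    change J s (J t y) = J t (J s y)
    refine (eqJ t ht _ _ _ h1 ?_).symm
    rw [← map_smul, ← map_add, e]
  have hadj : ∀ s : ℝ, s ≠ 0 → star (J s) = J (-s) := by
    intro s hs
    rw [ContinuousLinearMap.star_eq_adjoint]
    refine ((ContinuousLinearMap.eq_adjoint_iff _ _).2 fun y z => ?_).symm
    obtain ⟨w, hw, e⟩ := (hJ s hs).2 z
    obtain ⟨v, hv, e'⟩ := (hJ (-s) (neg_ne_zero.2 hs)).2 y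
    have h := graph_symm hA hv hw
    nth_rewrite 2 [← e']
    nth_rewrite 1 [← e]
    rw [inner_add_right, inner_add_left, inner_smul_left, inner_smul_right, h]
    simp
  have hlim0 : ∀ s : ℕ → ℝ, (∀ n, s n ≠ 0) → Filter.Tendsto s Filter.atTop (nhds 0) → ∀ φ,
      Filter.Tendsto (fun n => J (s n) φ) Filter.atTop (nhds φ) := by
    intro s hs hs0 φ
    rw [Metric.tendsto_atTop]
    intro ε hε
    obtain ⟨ψ, hψ, hd⟩ := Metric.mem_closure_iff.1 (hA.dense_domain φ) (ε / 3) (by positivity)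
    have hg := A.mem_graph ⟨ψ, hψ⟩
    set w := A ⟨ψ, hψ⟩
    have h0 : Filter.Tendsto (fun n => |s n| * ‖w‖) Filter.atTop (nhds 0) := by
      simpa using hs0.abs.mul_const ‖w‖
    obtain ⟨N, hN⟩ := Filter.eventually_atTop.1 (h0.eventually (gt_mem_nhds (show 0 < ε / 3 by positivity)))
    refine ⟨N, fun n hn => ?_⟩
    have h1 : ‖J (s n) ψ - ψ‖ ≤ |s n| * ‖w‖ := by
      have h2 := (hgraph (s n) (hs n) _ _ hg).2
      change J (s n) ψ + (Complex.I * s n) • J (s n) w = ψ at h2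
      have h3 : J (s n) ψ - ψ = -((Complex.I * s n) • J (s n) w) := by
        nth_rewrite 2 [← h2]; abel
      rw [h3, norm_neg, norm_smul]
      simp only [norm_mul, Complex.norm_I, one_mul, Complex.norm_real, Real.norm_eq_abs]
      gcongr
      exact (hJ _ (hs n)).1 w
    have h4 : ‖J (s n) (φ - ψ)‖ ≤ ‖φ - ψ‖ := (hJ _ (hs n)).1 _
    rw [dist_eq_norm] at hd ⊢
    have h5 : J (s n) φ - φ = J (s n) (φ - ψ) + (J (s n) ψ - ψ) + (ψ - φ) := by
      rw [map_sub]; abel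
    rw [h5]
    calc _ ≤ ‖J (s n) (φ - ψ)‖ + ‖J (s n) ψ - ψ‖ + ‖ψ - φ‖ := norm_add₃_le
      _ < ε / 3 + ε / 3 + ε / 3 := by
        have := hN n hn
        rw [norm_sub_rev ψ φ]
        linarith
      _ = ε := by ring
  let s : ℕ → ℝ := fun n => 1 / ((n : ℝ) + 1)
  have hs : ∀ n, s n ≠ 0 := fun n => by positivity
  have hs' : ∀ n, -s n ≠ 0 := fun n => neg_ne_zero.2 (hs n)
  have hs0 : Filter.Tendsto s Filter.atTop (nhds 0) := tendsto_one_div_add_atTop_nhds_zero_nat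
  refine ⟨fun n => (Complex.I / (2 * s n)) • (J (s n) - J (-s n)), fun n => ?_, fun m n => ?_, ?_⟩
  · have h := hadj (-s n) (hs' n)
    rw [neg_neg] at h
    rw [star_smul, star_sub, hadj _ (hs n), h, ← neg_sub (J (s n)), smul_neg, ← neg_smul]
    congr 1
    simp only [Complex.star_def, map_div₀, Complex.conj_I, map_mul, Complex.conj_ofReal,
      Complex.conj_ofNat]
    ring
  · rw [smul_mul_smul_comm, smul_mul_smul_comm, mul_comm (Complex.I / (2 * s m))]
    congr 1
    simp only [mul_sub, sub_mul, hcomm (s m) (s n) (hs m) (hs n),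
      hcomm (-s m) (s n) (hs' m) (hs n), hcomm (s m) (-s n) (hs m) (hs' n),
      hcomm (-s m) (-s n) (hs' m) (hs' n)]
    abel
  · intro φ ψ h
    have h1 : ∀ n, ((Complex.I / (2 * s n)) • (J (s n) - J (-s n))) φ
        = (1 / 2 : ℂ) • (J (s n) ψ + J (-s n) ψ) := fun n => by
      have e1 := (hgraph (s n) (hs n) _ _ h).2
      have e2 := (hgraph (-s n) (hs' n) _ _ h).2
      have e3 : J (s n) φ - J (-s n) φ = -((Complex.I * s n) • (J (s n) ψ + J (-s n) ψ)) := by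
        have e1' := eq_sub_of_add_eq e1
        have e2' := eq_sub_of_add_eq e2
        rw [e1', e2']
        push_cast
        rw [mul_neg, neg_smul, smul_add]
        abel
      rw [smul_apply, sub_apply, e3, smul_neg, smul_smul, ← neg_smul]
      congr 1
      have : (s n : ℂ) ≠ 0 := by exact_mod_cast hs n
      field_simp
      simp
    have h2 := ((hlim0 s hs hs0 ψ).add (hlim0 (fun n => -s n) hs' (by simpa using hs0.neg) ψ)).const_smul
      (1 / 2 : ℂ)
    have h3 : (1 / 2 : ℂ) • (ψ + ψ) = ψ := by
      rw [← two_smul ℂ ψ, smul_smul]; norm_num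
    rw [h3] at h2
    exact h2.congr fun n => (h1 n).symm

section Exp

variable {X Y : H →L[ℂ] H}

lemma exp_add_of_commute (h : Commute X Y) :
    NormedSpace.exp (X + Y) = NormedSpace.exp X * NormedSpace.exp Y := by
  let : NormedAlgebra ℚ (H →L[ℂ] H) := NormedAlgebra.restrictScalars ℚ ℂ _
  exact NormedSpace.exp_add_of_commute h

lemma norm_exp_apply (hX : star X = -X) (t : ℝ) (φ : H) : ‖NormedSpace.exp (t • X) φ‖ = ‖φ‖ := by
  have h1 : star (NormedSpace.exp (t • X)) = NormedSpace.exp (-(t • X)) := by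
    rw [NormedSpace.star_exp, star_smul, hX]
    simp
  have h2 : NormedSpace.exp (-(t • X)) * NormedSpace.exp (t • X) = 1 := by
    rw [← exp_add_of_commute (Commute.refl (t • X)).neg_left, neg_add_cancel,
      NormedSpace.exp_zero]
  have h3 : ⟪NormedSpace.exp (t • X) φ, NormedSpace.exp (t • X) φ⟫_ℂ = ⟪φ, φ⟫_ℂ := by
    rw [← ContinuousLinearMap.adjoint_inner_right, ← ContinuousLinearMap.star_eq_adjoint, h1,
      ← mul_apply_eq_comp, h2]
    rfl
  rw [@norm_eq_sqrt_re_inner ℂ, h3, ← @norm_eq_sqrt_re_inner ℂ]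

lemma hasDerivAt_exp_apply (X : H →L[ℂ] H) (t : ℝ) (φ : H) :
    HasDerivAt (fun s : ℝ => NormedSpace.exp (s • X) φ) (NormedSpace.exp (t • X) (X φ)) t := by
  have h := hasDerivAt_exp_smul_const (𝕂 := ℝ) X t
  exact ((ContinuousLinearMap.apply ℂ H φ).restrictScalars ℝ).hasFDerivAt.comp_hasDerivAt t h

lemma norm_exp_sub_le (hX : star X = -X) (t : ℝ) (φ : H) :
    ‖NormedSpace.exp (t • X) φ - φ‖ ≤ |t| * ‖X φ‖ := by
  have h := (convex_univ (𝕜 := ℝ) (E := ℝ)).norm_image_sub_le_of_norm_hasDerivWithin_le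
    (f := fun s : ℝ => NormedSpace.exp (s • X) φ) (C := ‖X φ‖) (x := 0) (y := t)
    (fun s _ => (hasDerivAt_exp_apply X s φ).hasDerivWithinAt)
    (fun s _ => (norm_exp_apply hX s _).le) trivial trivial
  simpa [NormedSpace.exp_zero, mul_comm] using h

lemma norm_exp_sub_sub_le (hX : star X = -X) (t : ℝ) (φ η : H) :
    ‖NormedSpace.exp (t • X) φ - φ - t • X φ‖ ≤ (2 * ‖X φ - η‖ + |t| * ‖X η‖) * |t| := by
  have hd : ∀ s : ℝ, HasDerivAt (fun s : ℝ => NormedSpace.exp (s • X) φ - s • X φ)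
      (NormedSpace.exp (s • X) (X φ) - X φ) s := fun s => by
    have h := (hasDerivAt_exp_apply X s φ).sub ((hasDerivAt_id s).smul_const (X φ))
    rw [one_smul] at h
    exact h
  have h := (convex_uIcc (0 : ℝ) t).norm_image_sub_le_of_norm_hasDerivWithin_le
    (f := fun s : ℝ => NormedSpace.exp (s • X) φ - s • X φ)
    (C := 2 * ‖X φ - η‖ + |t| * ‖X η‖) (x := 0) (y := t)
    (fun s _ => (hd s).hasDerivWithinAt)
    (fun s hs => by
      have h1 := norm_exp_sub_le hX s η
      have h2 : |s| ≤ |t| := by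
        simpa using Set.abs_sub_left_of_mem_uIcc hs
      have h3 : NormedSpace.exp (s • X) (X φ) - X φ = NormedSpace.exp (s • X) (X φ - η)
          + (NormedSpace.exp (s • X) η - η) + (η - X φ) := by
        rw [map_sub]; abel
      rw [h3]
      calc _ ≤ _ := norm_add₃_le
        _ ≤ ‖X φ - η‖ + |s| * ‖X η‖ + ‖X φ - η‖ := by
          rw [norm_exp_apply hX, norm_sub_rev η]
          gcongr
        _ ≤ ‖X φ - η‖ + |t| * ‖X η‖ + ‖X φ - η‖ := by gcongr
        _ = _ := by ring)
    Set.left_mem_uIcc Set.right_mem_uIcc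
  have e : NormedSpace.exp (t • X) φ - φ - t • X φ
      = NormedSpace.exp (t • X) φ - t • X φ
        - (NormedSpace.exp ((0 : ℝ) • X) φ - (0 : ℝ) • X φ) := by
    simp [NormedSpace.exp_zero]
    abel
  rw [e]
  simpa using h

lemma norm_exp_sub_exp_le (hX : star X = -X) (hY : star Y = -Y) (hXY : X * Y = Y * X) (t : ℝ)
    (φ : H) : ‖NormedSpace.exp (t • X) φ - NormedSpace.exp (t • Y) φ‖ ≤ |t| * ‖X φ - Y φ‖ := by
  have hc : Commute (t • Y) (t • (X - Y)) := by
    have : Commute Y (X - Y) := by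
      change Y * (X - Y) = (X - Y) * Y
      rw [mul_sub, sub_mul, hXY]
    exact (this.smul_left t).smul_right t
  have h1 : NormedSpace.exp (t • X) = NormedSpace.exp (t • Y) * NormedSpace.exp (t • (X - Y)) := by
    rw [← exp_add_of_commute hc]
    congr 1
    rw [smul_sub]; abel
  have h2 : star (X - Y) = -(X - Y) := by rw [star_sub, hX, hY]; abel
  rw [h1, mul_apply_eq_comp, ← map_sub, norm_exp_apply hY]
  exact norm_exp_sub_le h2 t φ

end Exp

/-- **Stone's theorem**: existence of the unitary group generated by a self-adjoint operator. -/
theorem exists_isUnitaryGroup (hA : IsSelfAdjoint A) :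
    ∃ V : ℝ → unitary (H →L[ℂ] H), IsUnitaryGroup A V := by
  obtain ⟨B, hB, hBB, hlim⟩ := exists_approx hA
  let X : ℕ → (H →L[ℂ] H) := fun n => Complex.I • B n
  have hX : ∀ n, star (X n) = -X n := fun n => by simp [X, hB]
  have hXX : ∀ m n, X m * X n = X n * X m := fun m n => by
    simp only [X, smul_mul_smul_comm, hBB m n]
  have hXlim : ∀ φ ψ, (φ, ψ) ∈ A.graph →
      Filter.Tendsto (fun n => X n φ) Filter.atTop (nhds (Complex.I • ψ)) := fun φ ψ h =>
    (hlim φ ψ h).const_smul Complex.I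
  let E : ℕ → ℝ → (H →L[ℂ] H) := fun n t => NormedSpace.exp (t • X n)
  have hEn : ∀ n t φ, ‖E n t φ‖ = ‖φ‖ := fun n t φ => norm_exp_apply (hX n) t φ
  have hconv : ∀ t φ, ∃ ψ, Filter.Tendsto (fun n => E n t φ) Filter.atTop (nhds ψ) := by
    intro t φ
    refine cauchySeq_tendsto_of_complete ?_
    rw [Metric.cauchySeq_iff]
    intro ε hε
    obtain ⟨η, hη, hd⟩ := Metric.mem_closure_iff.1 (hA.dense_domain φ) (ε / 3) (by positivity)
    have hc := (hXlim _ _ (A.mem_graph ⟨η, hη⟩)).cauchySeq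
    obtain ⟨N, hN⟩ := Metric.cauchySeq_iff.1 hc (ε / 3 / (|t| + 1)) (by positivity)
    refine ⟨N, fun m hm n hn => ?_⟩
    have h1 := norm_exp_sub_exp_le (hX m) (hX n) (hXX m n) t η
    have h2 := hN m hm n hn
    rw [dist_eq_norm] at hd h2 ⊢
    change ‖X m η - X n η‖ < _ at h2
    change ‖E m t η - E n t η‖ ≤ _ at h1
    have h3 : |t| * ‖X m η - X n η‖ ≤ ε / 3 := by
      rw [lt_div_iff₀ (by positivity)] at h2
      nlinarith [norm_nonneg (X m η - X n η)]
    have h4 : E m t φ - E n t φ = E m t (φ - η) + (E m t η - E n t η) - E n t (φ - η) := by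
      rw [map_sub, map_sub]; abel
    rw [h4]
    calc _ ≤ ‖E m t (φ - η)‖ + ‖E m t η - E n t η‖ + ‖E n t (φ - η)‖ :=
          (norm_sub_le _ _).trans (by gcongr; exact norm_add_le _ _)
      _ < ε := by rw [hEn, hEn]; linarith
  choose W hW using hconv
  let V : ℝ → (H →L[ℂ] H) := fun t =>
    continuousLinearMapOfTendsto (fun n => E n t) (f := W t) (tendsto_pi_nhds.2 (hW t))
  have hV : ∀ t φ, Filter.Tendsto (fun n => E n t φ) Filter.atTop (nhds (V t φ)) := hW
  have hVn : ∀ t φ, ‖V t φ‖ = ‖φ‖ := fun t φ => by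
    have h := (hV t φ).norm
    simp only [hEn] at h
    exact (tendsto_nhds_unique h tendsto_const_nhds)
  have hE_add : ∀ n s t, E n (s + t) = E n s * E n t := fun n s t => by
    simp only [E, add_smul]
    exact exp_add_of_commute (((Commute.refl (X n)).smul_left s).smul_right t)
  have hV_add : ∀ s t, V (s + t) = V s * V t := fun s t => by
    ext φ
    refine tendsto_nhds_unique (hV (s + t) φ) ?_
    have h1 : Filter.Tendsto (fun n => E n s (E n t φ - V t φ)) Filter.atTop (nhds 0) := by
      rw [tendsto_zero_iff_norm_tendsto_zero]
      simp only [hEn]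
      rw [← tendsto_zero_iff_norm_tendsto_zero]
      simpa using (hV t φ).sub_const (V t φ)
    have h2 := h1.add (hV s (V t φ))
    rw [zero_add] at h2
    refine h2.congr fun n => ?_
    rw [hE_add, map_sub, sub_add_cancel]
    rfl
  have hV0 : V 0 = 1 := by
    ext φ
    refine tendsto_nhds_unique (hV 0 φ) ?_
    simp [E, NormedSpace.exp_zero]
  have hVstar : ∀ t, star (V t) = V (-t) := fun t => by
    rw [ContinuousLinearMap.star_eq_adjoint]
    refine ((ContinuousLinearMap.eq_adjoint_iff _ _).2 fun x y => ?_).symm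
    have h1 := (hV (-t) x).inner (𝕜 := ℂ) (tendsto_const_nhds (x := y))
    have h2 := (tendsto_const_nhds (x := x)).inner (𝕜 := ℂ) (hV t y)
    refine tendsto_nhds_unique h1 (h2.congr fun n => ?_)
    have h3 : star (E n t) = E n (-t) := by
      simp [E, NormedSpace.star_exp, hX]
    rw [← h3, ContinuousLinearMap.star_eq_adjoint, ContinuousLinearMap.adjoint_inner_left]
  have hVinv : ∀ t, V (-t) * V t = 1 := fun t => by rw [← hV_add, neg_add_cancel, hV0]
  have hVinv' : ∀ t, V t * V (-t) = 1 := fun t => by rw [← hV_add, add_neg_cancel, hV0]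
  have hVd : ∀ φ ψ, (φ, ψ) ∈ A.graph → HasDerivAt (fun t => V t φ) (Complex.I • ψ) 0 := by
    intro φ ψ h
    have hest : ∀ t (η : H) w, (η, w) ∈ A.graph → ‖V t φ - φ - t • (Complex.I • ψ)‖
        ≤ (2 * ‖Complex.I • ψ - η‖ + |t| * ‖Complex.I • w‖) * |t| := by
      intro t η w hη
      have h1 := (((hV t φ).sub_const φ).sub ((hXlim φ ψ h).const_smul t)).norm
      have h2 := (((((hXlim φ ψ h).sub_const η).norm.const_mul 2).add
        ((hXlim η w hη).norm.const_mul |t|)).mul_const |t|)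
      exact le_of_tendsto_of_tendsto' h1 h2 fun n => norm_exp_sub_sub_le (hX n) t φ η
    rw [hasDerivAt_iff_isLittleO, Asymptotics.isLittleO_iff]
    intro c hc
    obtain ⟨η, hη, hd⟩ := Metric.mem_closure_iff.1 (hA.dense_domain (Complex.I • ψ)) (c / 4)
      (by positivity)
    have hg := A.mem_graph ⟨η, hη⟩
    set w := A ⟨η, hη⟩
    have h0 : Filter.Tendsto (fun t : ℝ => |t| * ‖Complex.I • w‖) (nhds 0) (nhds 0) := by
      have : Continuous fun t : ℝ => |t| * ‖Complex.I • w‖ := by fun_prop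
      simpa using this.tendsto 0
    filter_upwards [h0.eventually (gt_mem_nhds (show 0 < c / 2 by positivity))] with t ht
    rw [dist_eq_norm] at hd
    have h1 := hest t η w hg
    simp only [hV0, sub_zero, one_apply_eq_self, Real.norm_eq_abs]
    refine h1.trans ?_
    gcongr
    linarith
  have hVc0 : ∀ φ, Filter.Tendsto (fun t => V t φ) (nhds 0) (nhds φ) := by
    intro φ
    rw [Metric.tendsto_nhds]
    intro ε hε
    obtain ⟨η, hη, hd⟩ := Metric.mem_closure_iff.1 (hA.dense_domain φ) (ε / 3) (by positivity)
    have h1 := (hVd _ _ (A.mem_graph ⟨η, hη⟩)).continuousAt.tendsto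
    simp only [hV0, one_apply_eq_self] at h1
    filter_upwards [Metric.tendsto_nhds.1 h1 (ε / 3) (by positivity)] with t ht
    rw [dist_eq_norm] at hd ht ⊢
    have h4 : V t φ - φ = V t (φ - η) + (V t η - η) - (φ - η) := by rw [map_sub]; abel
    rw [h4]
    calc _ ≤ ‖V t (φ - η)‖ + ‖V t η - η‖ + ‖φ - η‖ :=
          (norm_sub_le _ _).trans (by gcongr; exact norm_add_le _ _)
      _ < ε := by rw [hVn]; linarith
  have hVc : ∀ φ, Continuous fun t => V t φ := by
    intro φ
    rw [continuous_iff_continuousAt]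
    intro s
    have h1 : Filter.Tendsto (fun t => V (t - s) φ) (nhds s) (nhds φ) :=
      (hVc0 φ).comp (by
        have : Continuous fun t : ℝ => t - s := by fun_prop
        simpa using this.tendsto s)
    have h2 := ((V s).continuous.tendsto φ).comp h1
    refine h2.congr fun t => ?_
    change (V s * V (t - s)) φ = V t φ
    rw [← hV_add, add_sub_cancel]
  refine ⟨fun t => ⟨V t, Unitary.mem_iff.2 (by rw [hVstar]; exact ⟨hVinv t, hVinv' t⟩)⟩,
    fun s t => Subtype.ext (hV_add s t), hVc, fun φ ψ => ⟨fun h => ?_, hVd φ ψ⟩⟩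
  refine mem_graph_of_forall hA fun x w hx => ?_
  have h1 := h.inner ℂ (hasDerivAt_const (0 : ℝ) x)
  have h2 : HasDerivAt (fun t => ⟪φ, V (-t) x⟫_ℂ) (⟪φ, -(Complex.I • w)⟫_ℂ) 0 := by
    have h3 : HasDerivAt (fun t : ℝ => V (-t) x) (-(Complex.I • w)) 0 := by
      have h4 := hVd x w hx
      rw [← neg_zero] at h4
      have h5 := h4.scomp (0 : ℝ) (hasDerivAt_neg (0 : ℝ))
      rw [neg_one_smul] at h5
      exact h5
    simpa using (hasDerivAt_const (0 : ℝ) φ).inner ℂ h3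
  have h3 : (fun t => ⟪V t φ, x⟫_ℂ) = fun t => ⟪φ, V (-t) x⟫_ℂ := by
    funext t
    rw [← hVstar, ContinuousLinearMap.star_eq_adjoint, ContinuousLinearMap.adjoint_inner_right]
  have h4 := h1.unique (h3 ▸ h2)
  rw [inner_zero_right, zero_add, inner_smul_left, inner_neg_right, inner_smul_right,
    Complex.conj_I, neg_mul, neg_inj] at h4
  exact mul_left_cancel₀ Complex.I_ne_zero h4

end Stone

/-- The unitary group `t ↦ e^{itA}` of a self-adjoint operator `A`. -/
def unitaryGroup (A : H →ₗ.[ℂ] H) (hA : IsSelfAdjoint A) : ℝ → unitary (H →L[ℂ] H) :=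
  (exists_isUnitaryGroup hA).choose

lemma isUnitaryGroup_unitaryGroup (A : H →ₗ.[ℂ] H) (hA : IsSelfAdjoint A) :
    IsUnitaryGroup A (unitaryGroup A hA) :=
  (exists_isUnitaryGroup hA).choose_spec

/-- `S` belongs to `C^k(A)`: the map `t ↦ e^{-itA} S e^{itA}` is strongly of class `C^k`. -/
def IsOfClass (k : ℕ) (A : H →ₗ.[ℂ] H) (hA : IsSelfAdjoint A) (S : H →L[ℂ] H) : Prop :=
  ∀ φ : H, ContDiff ℝ k fun t : ℝ =>
    (unitaryGroup A hA (-t) : H →L[ℂ] H) (S ((unitaryGroup A hA t : H →L[ℂ] H) φ))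

/-- `C` is the bounded operator associated with the form
`(φ, ψ) ↦ ⟨A φ, S ψ⟩ - ⟨φ, S A ψ⟩` on the domain of `A`. -/
def IsCommutator (A : H →ₗ.[ℂ] H) (S C : H →L[ℂ] H) : Prop :=
  ∀ φ ψ : A.domain, ⟪(φ : H), C ψ⟫_ℂ = ⟪A φ, S ψ⟫_ℂ - ⟪(φ : H), S (A ψ)⟫_ℂ

open Classical in
/-- The commutator `[A, S]`, for `S` of class `C¹(A)`. -/
def commutator (A : H →ₗ.[ℂ] H) (S : H →L[ℂ] H) : H →L[ℂ] H :=
  if h : ∃ C : H →L[ℂ] H, IsCommutator A S C then h.choose else 0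

end UnitarySpectral

end

/-! Write `φ_t = e^{itA} φ` with `φ` in the domain of `A`, and let `f'` be the derivative of a
function `f` on the circle with respect to the angle. The hypothesis says `[A, U] = g(U) U`, and
since `g(U)` commutes with `U` it gives `[A, U ^ n] = n g(U) U ^ n` for all integers `n`. As `i n z
^ n` is the derivative of `z ^ n`, this is the transport equation `d/dt ⟨φ_t, f(U) φ_t⟩ = -⟨φ_t, (g
f')(U) φ_t⟩` for trigonometric polynomials `f`: conjugation by `e^{itA}` moves the spectrum of `U`
along the vector field `g`.

Integration over `[0, T]` turns the right side into boundary terms, bounded by the sup norm of `f`,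
and that norm is bounded by the `L¹` norm of `f'` once `f` vanishes at one point. A function `k` is
a derivative only up to its mean value `c`, and the term with `c` is bounded by the `L¹` norm of `k`
as well. So the time average of `⟨φ_t, (g k)(U) φ_t⟩` is at most a constant times the `L¹` norm of
`k` (`norm_integral_inner_le`), first for trigonometric polynomials and by density for all
continuous `k`.

For `k = g w` with `0 ≤ w ≤ 1` the averaged quantity is `⟨ψ_t, w(U) ψ_t⟩`, where `ψ_t = g(U) φ_t`.
For small `t` it differs little from its value at `0`, uniformly in `w`. Hence the integral of `w`
against the spectral measure of `g(U) φ` is at most `ε + C_ε ∫ w`, which forces absolute continuity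
(`absolutelyContinuous_of_forall_integral_le`). Density of the domain gives the same for all `φ`.
Finally the spectral measure of `g(U) φ` is `g²` times that of `φ`, so the latter is absolutely
continuous where `g` does not vanish. -/

namespace UnitarySpectral

variable {H : Type*} [NormedAddCommGroup H] [InnerProductSpace ℂ H] [CompleteSpace H]

/-! ### Trigonometric polynomials and the functional calculus -/

/-- The function `z ↦ z ^ n` on the unit circle. -/
noncomputable def monomial (n : ℤ) : C(Circle, ℂ) :=
  ⟨fun z => ((z ^ n : Circle) : ℂ), continuous_subtype_val.comp (continuous_zpow n)⟩

lemma monomial_apply (n : ℤ) (z : Circle) : monomial n z = ((z ^ n : Circle) : ℂ) := rfl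

lemma monomial_zero : monomial 0 = 1 := by
  ext z; simp [monomial_apply]

lemma monomial_add (m n : ℤ) : monomial (m + n) = monomial m * monomial n := by
  ext z; simp [monomial_apply, zpow_add]

lemma star_monomial (n : ℤ) : star (monomial n) = monomial (-n) := by
  ext z
  simp only [ContinuousMap.star_apply, monomial_apply, zpow_neg, Circle.coe_inv_eq_conj]
  rfl

/-- Stone–Weierstrass: conjugation sends `z ^ n` to `z ^ (-n)`, and `z` alone separates points.
Products of monomials are monomials, so the algebra they generate is already their linear span. -/
lemma span_monomial_closure_eq_top :
    (Submodule.span ℂ (Set.range monomial)).topologicalClosure = ⊤ := by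
  let S : StarSubalgebra ℂ C(Circle, ℂ) :=
    { toSubalgebra := Algebra.adjoin ℂ (Set.range monomial)
      star_mem' := by
        change Algebra.adjoin ℂ (Set.range monomial) ≤ star (Algebra.adjoin ℂ (Set.range monomial))
        refine Algebra.adjoin_le ?_
        rintro - ⟨n, rfl⟩
        exact Algebra.subset_adjoin ⟨-n, (star_monomial n).symm⟩ }
  have hS : Subalgebra.toSubmodule S.toSubalgebra = Submodule.span ℂ (Set.range monomial) := by
    apply Algebra.adjoin_eq_span_of_subset
    refine Set.Subset.trans ?_ Submodule.subset_span
    intro x hx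
    refine Submonoid.closure_induction (fun _ => id) ⟨0, monomial_zero⟩ ?_ hx
    rintro - - - - ⟨m, rfl⟩ ⟨n, rfl⟩
    exact ⟨m + n, monomial_add m n⟩
  have hsep : S.SeparatesPoints := by
    intro x y hxy
    refine ⟨_, ⟨monomial 1, Algebra.subset_adjoin ⟨1, rfl⟩, rfl⟩, ?_⟩
    exact fun h => hxy (Circle.ext (by simpa [monomial_apply] using h))
  rw [← hS]
  exact congr_arg (Subalgebra.toSubmodule <| StarSubalgebra.toSubalgebra ·)
    (ContinuousMap.starSubalgebra_topologicalClosure_eq_top_of_separatesPoints S hsep)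

/-- A closed property of continuous functions on the circle that holds for all trigonometric
polynomials holds for all continuous functions. -/
lemma circle_induction {p : C(Circle, ℂ) → Prop} (hc : IsClosed {f | p f})
    (hp : ∀ f ∈ Submodule.span ℂ (Set.range monomial), p f) (f : C(Circle, ℂ)) : p f := by
  have h : f ∈ (Submodule.span ℂ (Set.range monomial)).topologicalClosure :=
    span_monomial_closure_eq_top ▸ Submodule.mem_top
  exact closure_minimal (s := (Submodule.span ℂ (Set.range monomial) : Set C(Circle, ℂ)))
    (t := {f | p f}) hp hc h

lemma norm_funCalc_le (U : unitary (H →L[ℂ] H)) (f : C(Circle, ℂ)) : ‖funCalc U f‖ ≤ ‖f‖ :=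
  NonUnitalStarAlgHom.norm_apply_le (funCalc U) f

lemma continuous_funCalc (U : unitary (H →L[ℂ] H)) : Continuous (funCalc U) :=
  AddMonoidHomClass.continuous_of_bound (funCalc U) 1 fun f => by
    simpa using norm_funCalc_le U f

lemma funCalc_monomial (U : unitary (H →L[ℂ] H)) (n : ℤ) :
    funCalc U (monomial n) = ((U ^ n : unitary (H →L[ℂ] H)) : H →L[ℂ] H) := by
  have h1 : funCalc U (monomial 1) = U := by
    rw [← funCalc_id U]
    congr 1
    ext z; rw [monomial_apply, zpow_one]; rfl
  induction n using Int.induction_on with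
  | zero => simp [monomial_zero]
  | succ n ih => rw [monomial_add, map_mul, ih, h1, zpow_add_one]; rfl
  | pred n ih =>
    rw [sub_eq_add_neg, monomial_add, map_mul, ih, ← star_monomial, map_star, h1,
      zpow_add, zpow_neg_one]
    rfl

lemma star_applyReal (U : unitary (H →L[ℂ] H)) (g : C(Circle, ℝ)) :
    star (applyReal U g) = applyReal U g := by
  have h1 : star (toComplex g) = toComplex g := by
    ext z; simp [toComplex]
  rw [applyReal, ← map_star, h1]

lemma commute_funCalc (U : unitary (H →L[ℂ] H)) (f g : C(Circle, ℂ)) :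
    Commute (funCalc U f) (funCalc U g) :=
  (Commute.all f g).map (funCalc U)

/-! ### Commutators with `A` and the unitary group -/

section Group

variable {A : H →ₗ.[ℂ] H}

lemma IsUnitaryGroup.map_zero {V : ℝ → unitary (H →L[ℂ] H)} (hV : IsUnitaryGroup A V) :
    V 0 = 1 := by
  have h := hV.map_add 0 0
  rw [add_zero] at h
  exact left_eq_mul.1 h

/-- The derivative at `0` is carried to `t` by `V s = V t * V (s - t)`. -/
lemma IsUnitaryGroup.hasDerivAt {V : ℝ → unitary (H →L[ℂ] H)} (hV : IsUnitaryGroup A V)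
    {φ w : H} (h : (φ, w) ∈ A.graph) (t : ℝ) :
    HasDerivAt (fun t => (V t : H →L[ℂ] H) φ) (Complex.I • (V t : H →L[ℂ] H) w) t := by
  have h0 := (hV.generator φ w).2 h
  have h1 : HasDerivAt (fun s => (V s : H →L[ℂ] H) φ) (Complex.I • w) (t - t) := by
    rwa [sub_self]
  have h2 := h1.scomp t (h := fun s => s - t) ((hasDerivAt_id t).sub_const t)
  have h3 := (((V t : H →L[ℂ] H).restrictScalars ℝ).hasFDerivAt).comp_hasDerivAt t h2
  convert h3 using 1
  · funext s
    have : V s = V t * V (s - t) := by rw [← hV.map_add, add_sub_cancel]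
    rw [this]
    rfl
  · simp

/-- Since `V t` commutes with every `V s`, it commutes with the generator and preserves its domain.
-/
lemma IsUnitaryGroup.apply_mem_graph {V : ℝ → unitary (H →L[ℂ] H)} (hV : IsUnitaryGroup A V)
    {φ w : H} (h : (φ, w) ∈ A.graph) (t : ℝ) :
    ((V t : H →L[ℂ] H) φ, (V t : H →L[ℂ] H) w) ∈ A.graph := by
  refine (hV.generator _ _).1 ?_
  have h0 := (hV.generator φ w).2 h
  have h3 := (((V t : H →L[ℂ] H).restrictScalars ℝ).hasFDerivAt).comp_hasDerivAt 0 h0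
  convert h3 using 1
  · funext s
    change (V s * V t : H →L[ℂ] H) φ = (V t * V s : H →L[ℂ] H) φ
    rw [← Submonoid.coe_mul, ← Submonoid.coe_mul, ← hV.map_add, add_comm, hV.map_add]
  · simp

lemma norm_unitary_apply (W : unitary (H →L[ℂ] H)) (φ : H) : ‖(W : H →L[ℂ] H) φ‖ = ‖φ‖ := by
  -- The squared norm is the total mass of the spectral measure, which `W` leaves unchanged.
  have h := spectralMeasure_univ W ((W : H →L[ℂ] H) φ)
  rw [spectralMeasure_apply_self, spectralMeasure_univ,
    ENNReal.ofReal_eq_ofReal_iff (by positivity) (by positivity)] at h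
  exact ((sq_eq_sq₀ (norm_nonneg _) (norm_nonneg _)).1 h).symm

lemma inner_star_apply (S : H →L[ℂ] H) (x y : H) : ⟪star S x, y⟫_ℂ = ⟪x, S y⟫_ℂ := by
  rw [ContinuousLinearMap.star_eq_adjoint, ContinuousLinearMap.adjoint_inner_left]

lemma inner_star_apply_right (S : H →L[ℂ] H) (x y : H) : ⟪x, star S y⟫_ℂ = ⟪S x, y⟫_ℂ := by
  rw [ContinuousLinearMap.star_eq_adjoint, ContinuousLinearMap.adjoint_inner_right]

/-- An operator of class `C¹(A)` has a bounded commutator with `A`. -/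
theorem IsOfClass.exists_isCommutator (hA : IsSelfAdjoint A) {S : H →L[ℂ] H}
    (hS : IsOfClass 1 A hA S) : ∃ C : H →L[ℂ] H, IsCommutator A S C := by
  have hV := isUnitaryGroup_unitaryGroup A hA
  set V := unitaryGroup A hA
  let F : ℝ → (H →L[ℂ] H) := fun t => (V (-t) : H →L[ℂ] H) * S * (V t : H →L[ℂ] H)
  have hd : ∀ φ, ∃ d, HasDerivAt (fun t => F t φ) d 0 := fun φ =>
    ⟨_, (((hS φ).differentiable one_ne_zero) 0).hasDerivAt⟩
  choose D hD using hd
  -- By Banach–Steinhaus the pointwise limit of the difference quotients is a bounded operator.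
  let D' : H →L[ℂ] H := continuousLinearMapOfTendsto
    (fun t : ℝ => t⁻¹ • (F t - F 0)) (f := D) (l := nhdsWithin 0 {0}ᶜ) (by
      refine tendsto_pi_nhds.2 fun φ => ?_
      have h := hasDerivAt_iff_tendsto_slope_zero.1 (hD φ)
      simpa using h)
  -- Differentiating `⟨V t φ, S (V t ψ)⟩` at `0` gives `-i` times the commutator form, the inner
  -- product being antilinear on the left; the factor `i` undoes this.
  refine ⟨Complex.I • D', fun φ ψ => ?_⟩
  have hφ := hV.hasDerivAt (A.mem_graph φ) 0
  have hψ := hV.hasDerivAt (A.mem_graph ψ) 0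
  have hSψ := ((S.restrictScalars ℝ).hasFDerivAt).comp_hasDerivAt 0 hψ
  have h1 := hφ.inner ℂ hSψ
  have h2 := (hasDerivAt_const (0 : ℝ) (φ : H)).inner ℂ (hD ψ)
  have h3 : (fun t => ⟪(V t : H →L[ℂ] H) φ,
      ((S.restrictScalars ℝ) ∘ fun t => (V t : H →L[ℂ] H) ψ) t⟫_ℂ)
      = fun t => ⟪(φ : H), F t ψ⟫_ℂ := by
    funext t
    have : (V (-t) : H →L[ℂ] H) = star (V t : H →L[ℂ] H) := by
      have h : V (-t) * V t = 1 := by rw [← hV.map_add, neg_add_cancel, hV.map_zero]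
      rw [eq_inv_of_mul_eq_one_left h]
      rfl
    change _ = ⟪(φ : H), (V (-t) : H →L[ℂ] H) (S ((V t : H →L[ℂ] H) ψ))⟫_ℂ
    rw [this, inner_star_apply_right]
    rfl
  have h4 := h1.unique (h3 ▸ h2)
  have h5 : ⟪(φ : H), (Complex.I • D') ψ⟫_ℂ = Complex.I * ⟪(φ : H), D ψ⟫_ℂ := by
    rw [smul_apply, inner_smul_right]; rfl
  simp only [hV.map_zero, inner_zero_left, add_zero] at h4
  rw [h5, ← h4]
  have h6 : ((S.restrictScalars ℝ) ∘ fun t => (V t : H →L[ℂ] H) ψ) 0 = S ψ := by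
    simp [hV.map_zero]
  rw [h6]
  simp [inner_smul_left, inner_smul_right, mul_add, ← mul_assoc]
  ring

lemma IsOfClass.isCommutator_commutator (hA : IsSelfAdjoint A) {S : H →L[ℂ] H}
    (hS : IsOfClass 1 A hA S) : IsCommutator A S (commutator A S) := by
  have h := hS.exists_isCommutator
  rw [commutator, dif_pos h]
  exact h.choose_spec

/-- Read with `φ` varying over the domain, the form identity puts `S x` in the domain of the adjoint
of `A`, which is `A` itself. The form commutator thus becomes an operator identity `A S x = S A x +
C x`. -/
lemma IsCommutator.apply_mem_graph (hA : IsSelfAdjoint A) {S C : H →L[ℂ] H}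
    (hC : IsCommutator A S C) {x w : H} (h : (x, w) ∈ A.graph) :
    (S x, S w + C x) ∈ A.graph := by
  obtain ⟨x', rfl, rfl⟩ := (LinearPMap.mem_graph_iff A).1 h
  refine mem_graph_of_forall hA fun y v hy => ?_
  obtain ⟨y', rfl, rfl⟩ := (LinearPMap.mem_graph_iff A).1 hy
  have h1 := congrArg (starRingEnd ℂ) (hC y' x')
  simp only [map_sub, inner_conj_symm] at h1
  rw [inner_add_left, h1]
  ring

/-- Taking adjoints reverses the sign of a commutator: `[A, S*] = -[A, S]*`. For unitary `S` this
gives access to the negative powers. -/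
lemma IsCommutator.star_apply_mem_graph (hA : IsSelfAdjoint A) {S C : H →L[ℂ] H}
    (hC : IsCommutator A S C) {x w : H} (h : (x, w) ∈ A.graph) :
    (star S x, star S w - star C x) ∈ A.graph := by
  refine mem_graph_of_forall hA fun y v hy => ?_
  have h1 := graph_symm hA h (hC.apply_mem_graph hA hy)
  rw [inner_add_right] at h1
  rw [inner_sub_left, inner_star_apply, inner_star_apply, inner_star_apply, h1]
  ring

/-- If `[A, U] = G U` with `G` commuting with `U`, then `[A, U ^ n] = n G U ^ n`. -/
lemma zpow_apply_mem_graph (hA : IsSelfAdjoint A) {U : unitary (H →L[ℂ] H)} {G : H →L[ℂ] H}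
    (hG : star G = G) (hGU : Commute G (U : H →L[ℂ] H))
    (hC : IsCommutator A (U : H →L[ℂ] H) (G * U)) {x w : H} (h : (x, w) ∈ A.graph) (n : ℤ) :
    (((U ^ n : unitary (H →L[ℂ] H)) : H →L[ℂ] H) x,
      ((U ^ n : unitary (H →L[ℂ] H)) : H →L[ℂ] H) w
        + (n : ℂ) • (G * ((U ^ n : unitary (H →L[ℂ] H)) : H →L[ℂ] H)) x) ∈ A.graph := by
  have hGU' : star (U : H →L[ℂ] H) * G = G * star (U : H →L[ℂ] H) := by
    have := congrArg star hGU.eq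
    rwa [star_mul, star_mul, hG] at this
  induction n using Int.induction_on with
  | zero => simpa using h
  | succ n ih =>
    have h1 := hC.apply_mem_graph hA ih
    rw [zpow_add_one, ← (Commute.refl U).zpow_right n |>.eq]
    convert h1 using 2
    · rfl
    set W := ((U ^ (n : ℤ) : unitary (H →L[ℂ] H)) : H →L[ℂ] H)
    have e : (U : H →L[ℂ] H) (G (W x)) = G ((U : H →L[ℂ] H) (W x)) :=
      congrArg (fun T : H →L[ℂ] H => T (W x)) hGU.eq.symm
    simp only [Submonoid.coe_mul, map_add, map_smul, mul_apply_eq_comp, e]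
    push_cast
    rw [add_smul, one_smul, add_assoc]
  | pred n ih =>
    -- Here `(G U)* = U* G = G U*`, so each factor `U*` contributes `-G` and lowers the coefficient
    -- by one.
    have h1 := hC.star_apply_mem_graph hA ih
    have e0 : U ^ (-(n : ℤ) - 1) = star U * U ^ (-(n : ℤ)) := by
      rw [zpow_sub_one, ← ((Commute.refl U).inv_left.zpow_right _).eq]
      rfl
    rw [e0]
    convert h1 using 2
    · rfl
    set W := ((U ^ (-(n : ℤ)) : unitary (H →L[ℂ] H)) : H →L[ℂ] H)
    have e : ∀ y, star (U : H →L[ℂ] H) (G y) = G (star (U : H →L[ℂ] H) y) := fun y =>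
      congrArg (fun T : H →L[ℂ] H => T y) hGU'
    simp only [Submonoid.coe_mul, map_add, map_smul, mul_apply_eq_comp, star_mul, hG, e,
      Unitary.coe_star]
    push_cast
    rw [sub_smul, one_smul, add_sub_assoc]

end Group

/-! ### Primitives on the circle and the arc length -/

instance : IsFiniteMeasure arcLength := by
  unfold arcLength
  infer_instance

lemma integral_arcLength {E : Type*} [NormedAddCommGroup E] [NormedSpace ℝ E] {F : Circle → E}
    (hF : Continuous F) :
    ∫ z, F z ∂arcLength = ∫ θ in (-Real.pi)..Real.pi, F (Circle.exp θ) := by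
  rw [arcLength, integral_map Circle.exp.continuous.aemeasurable hF.aestronglyMeasurable,
    intervalIntegral.integral_of_le (by linarith [Real.pi_pos])]

lemma hasDerivAt_monomial_exp (n : ℤ) (θ : ℝ) :
    HasDerivAt (fun θ : ℝ => monomial n (Circle.exp θ))
      (Complex.I * n * monomial n (Circle.exp θ)) θ := by
  have e : ∀ θ : ℝ, monomial n (Circle.exp θ) = Complex.exp (n * (θ * Complex.I)) := fun θ => by
    rw [monomial_apply, Circle.coe_zpow, Circle.coe_exp, Complex.exp_int_mul]
  simp only [e]
  have h : HasDerivAt (fun θ : ℝ => (n : ℂ) * ((θ : ℂ) * Complex.I)) (n * (1 * Complex.I)) θ :=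
    ((Complex.ofRealCLM.hasDerivAt (x := θ)).mul_const Complex.I).const_mul (n : ℂ)
  convert h.cexp using 1
  ring

/-- If `k - c` is the derivative of a function `f` on the circle, then `c` is the mean value of `k`,
and the oscillation of `f` is controlled by the `L¹` norm of `k`. -/
lemma norm_const_le_of_hasDerivAt {f k : C(Circle, ℂ)} {c : ℂ}
    (h : ∀ θ : ℝ, HasDerivAt (fun θ : ℝ => f (Circle.exp θ)) (k (Circle.exp θ) - c) θ) :
    2 * Real.pi * ‖c‖ ≤ ∫ z, ‖k z‖ ∂arcLength := by
  have hc : Continuous fun θ : ℝ => k (Circle.exp θ) := by fun_prop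
  have h1 := intervalIntegral.integral_eq_sub_of_hasDerivAt (a := -Real.pi) (b := Real.pi)
    (fun θ _ => h θ) ((hc.sub continuous_const).intervalIntegrable _ _)
  -- Both endpoints are the same point of the circle, so the integral of `k - c` over one period
  -- vanishes and `2πc` is the integral of `k`.
  have h2 : Circle.exp Real.pi = Circle.exp (-Real.pi) := by
    have := Circle.periodic_exp (-Real.pi)
    rw [← this]; congr 1; ring
  rw [h2, sub_self, intervalIntegral.integral_sub (hc.intervalIntegrable _ _)
    intervalIntegrable_const, intervalIntegral.integral_const, sub_eq_zero] at h1
  rw [integral_arcLength (by fun_prop)]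
  have h3 := intervalIntegral.norm_integral_le_integral_norm (μ := volume)
    (f := fun θ : ℝ => k (Circle.exp θ)) (by linarith [Real.pi_pos] : -Real.pi ≤ Real.pi)
  rw [h1, norm_smul, Real.norm_of_nonneg (by linarith [Real.pi_pos])] at h3
  convert h3 using 2
  ring

/-- Along the arc from `-π` to the angle of `z`, the increment of `f` is at most the `L¹` norm of `k
- c`. The constant contributes at most `2π‖c‖`, itself bounded by the `L¹` norm of `k`; hence the
factor `2`. -/
lemma norm_sub_le_of_hasDerivAt {f k : C(Circle, ℂ)} {c : ℂ}
    (h : ∀ θ : ℝ, HasDerivAt (fun θ : ℝ => f (Circle.exp θ)) (k (Circle.exp θ) - c) θ)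
    (z : Circle) :
    ‖f z - f (Circle.exp (-Real.pi))‖ ≤ 2 * ∫ z, ‖k z‖ ∂arcLength := by
  have hc : Continuous fun θ : ℝ => k (Circle.exp θ) := by fun_prop
  obtain ⟨θ, hθ, rfl⟩ : ∃ θ ∈ Set.Icc (-Real.pi) Real.pi, Circle.exp θ = z :=
    ⟨Complex.arg z, ⟨(Complex.neg_pi_lt_arg _).le, Complex.arg_le_pi _⟩, Circle.exp_arg z⟩
  have h1 := intervalIntegral.integral_eq_sub_of_hasDerivAt (a := -Real.pi) (b := θ)
    (fun θ _ => h θ) ((hc.sub continuous_const).intervalIntegrable _ _)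
  have h4 := norm_const_le_of_hasDerivAt h
  rw [← h1]
  rw [integral_arcLength (by fun_prop)] at h4 ⊢
  calc ‖∫ s in (-Real.pi)..θ, (k (Circle.exp s) - c)‖
      ≤ ∫ s in (-Real.pi)..θ, ‖k (Circle.exp s) - c‖ :=
        intervalIntegral.norm_integral_le_integral_norm hθ.1
    _ ≤ ∫ s in (-Real.pi)..Real.pi, ‖k (Circle.exp s) - c‖ :=
        intervalIntegral.integral_mono_interval le_rfl hθ.1 hθ.2
          (Filter.Eventually.of_forall fun _ => norm_nonneg _)
          ((hc.sub continuous_const).norm.intervalIntegrable _ _)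
    _ ≤ ∫ s in (-Real.pi)..Real.pi, (‖k (Circle.exp s)‖ + ‖c‖) :=
        intervalIntegral.integral_mono_on (by linarith [Real.pi_pos])
          ((hc.sub continuous_const).norm.intervalIntegrable _ _)
          ((hc.norm.add continuous_const).intervalIntegrable _ _) fun _ _ => norm_sub_le _ _
    _ = (∫ s in (-Real.pi)..Real.pi, ‖k (Circle.exp s)‖) + 2 * Real.pi * ‖c‖ := by
        rw [intervalIntegral.integral_add (hc.norm.intervalIntegrable _ _)
          intervalIntegrable_const, intervalIntegral.integral_const, smul_eq_mul]
        ring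
    _ ≤ _ := by linarith

/-! ### The transport equation and its time average -/

section Evolution

variable {A : H →ₗ.[ℂ] H} {V : ℝ → unitary (H →L[ℂ] H)} {U : unitary (H →L[ℂ] H)}
  {g : C(Circle, ℝ)}

/-- The derivative is `-i⟨φ_t, [A, U ^ n] φ_t⟩`, where `φ_t = V t φ` stays in the domain of `A`, and
`[A, U ^ n] = n g(U) U ^ n`. This is the transport equation for `f = z ^ n`. -/
lemma hasDerivAt_inner_monomial (hA : IsSelfAdjoint A) (hV : IsUnitaryGroup A V)
    (hC : IsCommutator A (U : H →L[ℂ] H) (applyReal U g * U)) {φ w : H} (h : (φ, w) ∈ A.graph)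
    (n : ℤ) (t : ℝ) :
    HasDerivAt (fun t => ⟪(V t : H →L[ℂ] H) φ, funCalc U (monomial n) ((V t : H →L[ℂ] H) φ)⟫_ℂ)
      (-(Complex.I * n *
        ⟪(V t : H →L[ℂ] H) φ, funCalc U (toComplex g * monomial n) ((V t : H →L[ℂ] H) φ)⟫_ℂ)) t := by
  have hcomm : Commute (applyReal U g) (U : H →L[ℂ] H) := by
    rw [← funCalc_id U]
    exact commute_funCalc U _ _
  have h1 := hV.hasDerivAt h t
  have h2 := (((funCalc U (monomial n)).restrictScalars ℝ).hasFDerivAt).comp_hasDerivAt t h1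
  have h3 := h1.inner ℂ h2
  have hg := hV.apply_mem_graph h t
  have h4 := graph_symm hA hg (zpow_apply_mem_graph hA (star_applyReal U g) hcomm hC hg n)
  refine h3.congr_deriv ?_
  rw [map_mul, funCalc_monomial]
  change ⟪_, ((U ^ n : unitary (H →L[ℂ] H)) : H →L[ℂ] H) _⟫_ℂ +
    ⟪_, ((U ^ n : unitary (H →L[ℂ] H)) : H →L[ℂ] H) _⟫_ℂ = -(_ * ⟪_, (applyReal U g * _) _⟫_ℂ)
  rw [map_smul, inner_smul_left, inner_smul_right, h4, inner_add_right, inner_smul_right,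
    Complex.conj_I]
  ring

/-- Conservation of the norm: adding a constant to `f` does not affect the transport equation, so
`f` may be normalised to vanish at a chosen point. -/
lemma hasDerivAt_inner_unitary_self (V : ℝ → unitary (H →L[ℂ] H)) (φ : H) (t : ℝ) :
    HasDerivAt (fun t => ⟪(V t : H →L[ℂ] H) φ, (V t : H →L[ℂ] H) φ⟫_ℂ) 0 t := by
  simp only [inner_self_eq_norm_sq_to_K, norm_unitary_apply]
  exact hasDerivAt_const _ _

/-- A trigonometric polynomial `k` is the sum of a constant `c` and the derivative of a function
`f`, and the evolution of `f(U)` is governed by `(g (k - c))(U)`. -/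
lemma exists_primitive (hA : IsSelfAdjoint A) (hV : IsUnitaryGroup A V)
    (hC : IsCommutator A (U : H →L[ℂ] H) (applyReal U g * U))
    {k : C(Circle, ℂ)} (hk : k ∈ Submodule.span ℂ (Set.range monomial)) :
    ∃ (f : C(Circle, ℂ)) (c : ℂ),
      (∀ θ : ℝ, HasDerivAt (fun θ : ℝ => f (Circle.exp θ)) (k (Circle.exp θ) - c) θ) ∧
      ∀ φ ∈ A.domain, ∀ t,
        HasDerivAt (fun t => ⟪(V t : H →L[ℂ] H) φ, funCalc U f ((V t : H →L[ℂ] H) φ)⟫_ℂ)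
          (-⟪(V t : H →L[ℂ] H) φ,
            funCalc U (toComplex g * (k - c • 1)) ((V t : H →L[ℂ] H) φ)⟫_ℂ) t := by
  induction hk using Submodule.span_induction with
  | mem k hk =>
    obtain ⟨n, rfl⟩ := hk
    -- The constant monomial has no periodic primitive and goes entirely into `c`; the others are
    -- divided by `i n`.
    by_cases hn : n = 0
    · subst hn
      refine ⟨0, 1, fun θ => ?_, fun φ _ t => ?_⟩
      · simpa [monomial_zero] using hasDerivAt_const θ (0 : ℂ)
      · simpa [monomial_zero] using hasDerivAt_const t (0 : ℂ)
    · have hn' : Complex.I * n ≠ 0 := by simp [hn]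
      refine ⟨(Complex.I * n)⁻¹ • monomial n, 0, fun θ => ?_, fun φ hφ t => ?_⟩
      · have h := (hasDerivAt_monomial_exp n θ).const_mul (Complex.I * n)⁻¹
        rw [inv_mul_cancel_left₀ hn'] at h
        rw [sub_zero]
        exact h
      · have h := (hasDerivAt_inner_monomial hA hV hC (A.mem_graph ⟨φ, hφ⟩) n t).const_mul
          (Complex.I * n)⁻¹
        rw [mul_neg, inv_mul_cancel_left₀ hn'] at h
        simp only [map_smul, smul_apply, inner_smul_right, zero_smul, sub_zero]
        exact h
  | zero =>
    refine ⟨0, 0, fun θ => ?_, fun φ _ t => ?_⟩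
    · simpa using hasDerivAt_const θ (0 : ℂ)
    · simpa using hasDerivAt_const t (0 : ℂ)
  | add k₁ k₂ _ _ ih₁ ih₂ =>
    obtain ⟨f₁, c₁, h₁, h₁'⟩ := ih₁
    obtain ⟨f₂, c₂, h₂, h₂'⟩ := ih₂
    refine ⟨f₁ + f₂, c₁ + c₂, fun θ => ?_, fun φ hφ t => ?_⟩
    · refine ((h₁ θ).add (h₂ θ)).congr_deriv ?_
      rw [ContinuousMap.add_apply]; ring
    · have h := (h₁' φ hφ t).add (h₂' φ hφ t)
      have e : toComplex g * (k₁ + k₂ - (c₁ + c₂) • 1)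
          = toComplex g * (k₁ - c₁ • 1) + toComplex g * (k₂ - c₂ • 1) := by
        rw [add_smul]; ring
      rw [e]
      simp only [map_add, add_apply, inner_add_right, neg_add]
      exact h
  | smul a k _ ih =>
    obtain ⟨f, c, h, h'⟩ := ih
    refine ⟨a • f, a * c, fun θ => ?_, fun φ hφ t => ?_⟩
    · refine ((h θ).const_mul a).congr_deriv ?_
      rw [ContinuousMap.smul_apply, smul_eq_mul]; ring
    · have h := (h' φ hφ t).const_mul a
      have e : toComplex g * (a • k - (a * c) • 1) = a • (toComplex g * (k - c • 1)) := by
        rw [mul_smul, ← smul_sub, mul_smul_comm]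
      rw [e]
      simp only [map_smul, smul_apply, inner_smul_right, ← mul_neg]
      exact h

lemma norm_inner_funCalc_le (U : unitary (H →L[ℂ] H)) (f : C(Circle, ℂ)) (φ : H) :
    ‖⟪φ, funCalc U f φ⟫_ℂ‖ ≤ ‖f‖ * ‖φ‖ ^ 2 := by
  calc _ ≤ ‖φ‖ * ‖funCalc U f φ‖ := norm_inner_le_norm _ _
    _ ≤ ‖φ‖ * (‖f‖ * ‖φ‖) := by
      gcongr
      exact (funCalc U f).le_of_opNorm_le (norm_funCalc_le U f) φ
    _ = _ := by ring

lemma continuous_inner_funCalc (hV : IsUnitaryGroup A V) (φ : H) :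
    Continuous fun p : C(Circle, ℂ) × ℝ =>
      ⟪(V p.2 : H →L[ℂ] H) φ, funCalc U p.1 ((V p.2 : H →L[ℂ] H) φ)⟫_ℂ := by
  have h1 : Continuous fun p : C(Circle, ℂ) × ℝ => (V p.2 : H →L[ℂ] H) φ :=
    (hV.continuous φ).comp continuous_snd
  have h2 : Continuous fun p : C(Circle, ℂ) × ℝ => funCalc U p.1 :=
    (continuous_funCalc U).comp continuous_fst
  exact h1.inner (h2.clm_apply h1)

/-- The time averages of `(g k)(U)` along the evolution are controlled by the `L¹` norm of `k`. -/
theorem norm_integral_inner_le (hA : IsSelfAdjoint A) (hV : IsUnitaryGroup A V)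
    (hC : IsCommutator A (U : H →L[ℂ] H) (applyReal U g * U)) {φ : H} (hφ : φ ∈ A.domain)
    {T : ℝ} (hT : 0 ≤ T) (k : C(Circle, ℂ)) :
    ‖∫ t in (0 : ℝ)..T, ⟪(V t : H →L[ℂ] H) φ,
        funCalc U (toComplex g * k) ((V t : H →L[ℂ] H) φ)⟫_ℂ‖
      ≤ (4 + T * ‖toComplex g‖) * ‖φ‖ ^ 2 * ∫ z, ‖k z‖ ∂arcLength := by
  have hcont := continuous_inner_funCalc (U := U) hV φ
  -- Both sides are continuous in `k` for the sup norm, so trigonometric polynomials suffice.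
  refine circle_induction (p := fun k => ‖∫ t in (0 : ℝ)..T, ⟪(V t : H →L[ℂ] H) φ,
        funCalc U (toComplex g * k) ((V t : H →L[ℂ] H) φ)⟫_ℂ‖
      ≤ (4 + T * ‖toComplex g‖) * ‖φ‖ ^ 2 * ∫ z, ‖k z‖ ∂arcLength) ?_ (fun k hk => ?_) k
  · refine isClosed_le (Continuous.norm ?_) (Continuous.mul continuous_const ?_)
    · refine intervalIntegral.continuous_parametric_intervalIntegral_of_continuous' ?_ 0 T
      exact hcont.comp (by fun_prop :
        Continuous fun p : C(Circle, ℂ) × ℝ => (toComplex g * p.1, p.2))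
    · have e : ∀ k : C(Circle, ℂ), ∫ z, ‖k z‖ ∂arcLength
          = ∫ θ in (-Real.pi)..Real.pi, ‖k (Circle.exp θ)‖ :=
        fun k => integral_arcLength (by fun_prop)
      simp only [e]
      refine intervalIntegral.continuous_parametric_intervalIntegral_of_continuous' ?_ _ _
      change Continuous fun p : C(Circle, ℂ) × ℝ => ‖p.1 (Circle.exp p.2)‖
      fun_prop
  · obtain ⟨f, c, hd, hf⟩ := exists_primitive hA hV hC hk
    set I := ∫ z, ‖k z‖ ∂arcLength with hI
    have hc := norm_const_le_of_hasDerivAt hd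
    have hI0 : 0 ≤ I := integral_nonneg fun _ => norm_nonneg _
    -- From `2π‖c‖ ≤ I` and `2π ≥ 1`.
    have hc' : ‖c‖ ≤ I := by
      nlinarith [Real.pi_gt_three, norm_nonneg c]
    -- Normalised to vanish at the base point, so that its sup norm is bounded by the oscillation
    -- estimate.
    set f₀ : C(Circle, ℂ) := f - f (Circle.exp (-Real.pi)) • 1 with hf₀
    have hfn : ‖f₀‖ ≤ 2 * I := by
      refine (ContinuousMap.norm_le _ (by positivity)).2 fun z => ?_
      simpa [hf₀] using norm_sub_le_of_hasDerivAt hd z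
    let q : C(Circle, ℂ) → ℝ → ℂ := fun f t =>
      ⟪(V t : H →L[ℂ] H) φ, funCalc U f ((V t : H →L[ℂ] H) φ)⟫_ℂ
    have hqc : ∀ f, Continuous (q f) := fun f => hcont.comp (by fun_prop :
        Continuous fun t : ℝ => (f, t))
    have hqn : ∀ f t, ‖q f t‖ ≤ ‖f‖ * ‖φ‖ ^ 2 := fun f t => by
      have := norm_inner_funCalc_le U f ((V t : H →L[ℂ] H) φ)
      rwa [norm_unitary_apply] at this
    have hd₀ : ∀ t, HasDerivAt (q f₀) (-q (toComplex g * (k - c • 1)) t) t := fun t => by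
      have h := (hf φ hφ t).sub ((hasDerivAt_inner_unitary_self V φ t).const_mul
        (f (Circle.exp (-Real.pi))))
      rw [mul_zero, sub_zero] at h
      refine h.congr_of_eventuallyEq (Filter.Eventually.of_forall fun s => ?_)
      simp [q, hf₀]
    have h1 := intervalIntegral.integral_eq_sub_of_hasDerivAt (a := 0) (b := T)
      (fun t _ => hd₀ t) ((hqc _).neg.intervalIntegrable _ _)
    have h2 : ∀ t, q (toComplex g * k) t
        = -(-q (toComplex g * (k - c • 1)) t) + c * q (toComplex g) t := fun t => by
      have : toComplex g * k = toComplex g * (k - c • 1) + c • toComplex g := by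
        rw [mul_sub, mul_smul_comm, mul_one, sub_add_cancel]
      simp only [q]
      rw [this, map_add, add_apply, inner_add_right, map_smul, smul_apply, inner_smul_right,
        neg_neg]
    have h3 : ∫ t in (0 : ℝ)..T, q (toComplex g * k) t
        = -(q f₀ T - q f₀ 0) + c * ∫ t in (0 : ℝ)..T, q (toComplex g) t := by
      simp only [h2]
      have e := intervalIntegral.integral_add (a := 0) (b := T) (μ := volume)
        ((hqc (toComplex g * (k - c • 1))).neg.neg.intervalIntegrable _ _)
        (((hqc (toComplex g)).const_mul c).intervalIntegrable _ _)
      refine e.trans ?_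
      rw [intervalIntegral.integral_const_mul, ← h1, ← intervalIntegral.integral_neg]
      rfl
    have h4 : ‖∫ t in (0 : ℝ)..T, q (toComplex g) t‖ ≤ ‖toComplex g‖ * ‖φ‖ ^ 2 * |T - 0| :=
      intervalIntegral.norm_integral_le_of_norm_le_const fun t _ => hqn _ t
    rw [sub_zero, abs_of_nonneg hT] at h4
    change ‖∫ t in (0 : ℝ)..T, q (toComplex g * k) t‖ ≤ _
    rw [h3]
    -- Each of the two endpoints costs `2I`, whence the constant `4`; the mean value `c` accounts
    -- for the term linear in `T`.
    calc _ ≤ ‖q f₀ T‖ + ‖q f₀ 0‖ + ‖c‖ * ‖∫ t in (0 : ℝ)..T, q (toComplex g) t‖ := by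
          refine (norm_add_le _ _).trans ?_
          rw [norm_neg, norm_mul]
          gcongr
          exact norm_sub_le _ _
      _ ≤ ‖f₀‖ * ‖φ‖ ^ 2 + ‖f₀‖ * ‖φ‖ ^ 2 + I * (‖toComplex g‖ * ‖φ‖ ^ 2 * T) := by
          gcongr <;> exact hqn _ _
      _ ≤ 2 * I * ‖φ‖ ^ 2 + 2 * I * ‖φ‖ ^ 2 + I * (‖toComplex g‖ * ‖φ‖ ^ 2 * T) := by
          gcongr
      _ = _ := by ring

end Evolution

/-! ### A criterion for absolute continuity -/

lemma toComplex_mul (f g : C(Circle, ℝ)) : toComplex (f * g) = toComplex f * toComplex g := by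
  ext z; simp [toComplex]

lemma norm_applyReal_le (U : unitary (H →L[ℂ] H)) {w : C(Circle, ℝ)}
    (hw : ∀ z, w z ∈ Set.Icc (0 : ℝ) 1) : ‖applyReal U w‖ ≤ 1 := by
  refine (norm_funCalc_le U _).trans ((ContinuousMap.norm_le _ zero_le_one).2 fun z => ?_)
  change ‖(w z : ℂ)‖ ≤ 1
  rw [Complex.norm_real, Real.norm_of_nonneg (hw z).1]
  exact (hw z).2

/-- The bound does not involve `w`, so one time interval will serve for all test functions at once.
-/
lemma abs_inner_applyReal_sub_le (U : unitary (H →L[ℂ] H)) {w : C(Circle, ℝ)}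
    (hw : ∀ z, w z ∈ Set.Icc (0 : ℝ) 1) (x y : H) :
    |(⟪x, applyReal U w x⟫_ℂ).re - (⟪y, applyReal U w y⟫_ℂ).re| ≤ (‖x‖ + ‖y‖) * ‖x - y‖ := by
  have h : ∀ v, ‖applyReal U w v‖ ≤ ‖v‖ := fun v => by
    simpa using (applyReal U w).le_of_opNorm_le (norm_applyReal_le U hw) v
  have e : ⟪x, applyReal U w x⟫_ℂ - ⟪y, applyReal U w y⟫_ℂ
      = ⟪x, applyReal U w (x - y)⟫_ℂ + ⟪x - y, applyReal U w y⟫_ℂ := by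
    rw [map_sub, inner_sub_right, inner_sub_left]; ring
  rw [← Complex.sub_re, e]
  calc _ ≤ _ := Complex.abs_re_le_norm _
    _ ≤ _ := norm_add_le _ _
    _ ≤ ‖x‖ * ‖applyReal U w (x - y)‖ + ‖x - y‖ * ‖applyReal U w y‖ :=
      add_le_add (norm_inner_le_norm _ _) (norm_inner_le_norm _ _)
    _ ≤ ‖x‖ * ‖x - y‖ + ‖x - y‖ * ‖y‖ := by gcongr <;> exact h _
    _ = _ := by ring

/-- A finite measure on the circle is absolutely continuous if its integrals of continuous functions
with values in `[0, 1]` are controlled, up to a small error, by those of the arc length measure. -/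
lemma absolutelyContinuous_of_forall_integral_le {μ : Measure Circle} [IsFiniteMeasure μ]
    [μ.Regular] (h : ∀ ε > 0, ∃ C : ℝ, ∀ w : C(Circle, ℝ), (∀ z, w z ∈ Set.Icc (0 : ℝ) 1) →
      ∫ z, w z ∂μ ≤ ε + C * ∫ z, w z ∂arcLength) : μ ≪ arcLength := by
  refine Measure.AbsolutelyContinuous.mk fun N hN hN0 => ?_
  -- Inner regularity reduces the claim to compact null sets, whose indicators are limits of
  -- continuous functions.
  rw [hN.measure_eq_iSup_isCompact_of_ne_top (measure_ne_top μ N)]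
  simp only [ENNReal.iSup_eq_zero]
  intro K hKN hK
  have hK0 : arcLength K = 0 := measure_mono_null hKN hN0
  have hδ : ∀ n : ℕ, (0 : ℝ) < 1 / ((n : ℝ) + 1) := fun n => Nat.one_div_pos_of_nat
  -- These functions equal `1` on `K` and converge pointwise to its indicator, as `K` is closed;
  -- their arc length integrals tend to that of `K`, which is zero.
  let w : ℕ → C(Circle, ℝ) := fun n =>
    ⟨fun z => (thickenedIndicator (hδ n) K z : ℝ), by fun_prop⟩
  have hw : ∀ n z, w n z ∈ Set.Icc (0 : ℝ) 1 := fun n z =>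
    ⟨NNReal.coe_nonneg _, NNReal.coe_le_coe.2 (thickenedIndicator_le_one (hδ n) K z)⟩
  have hlim : Filter.Tendsto (fun n => ∫ z, w n z ∂arcLength) Filter.atTop (nhds 0) := by
    have h1 := tendsto_integral_of_dominated_convergence (μ := arcLength)
      (F := fun n z => w n z) (f := fun z => ((K.indicator (fun _ => (1 : NNReal)) z : NNReal) : ℝ))
      (fun _ => (1 : ℝ)) (fun n => (w n).continuous.aestronglyMeasurable) (integrable_const _)
      (fun n => Filter.Eventually.of_forall fun z => by
        rw [Real.norm_of_nonneg (hw n z).1]; exact (hw n z).2)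
      (Filter.Eventually.of_forall fun z => by
        have h2 := thickenedIndicator_tendsto_indicator_closure hδ
          tendsto_one_div_add_atTop_nhds_zero_nat K
        rw [hK.isClosed.closure_eq] at h2
        exact (NNReal.continuous_coe.tendsto _).comp ((tendsto_pi_nhds.1 h2) z))
    have h3 : ∫ z, ((K.indicator (fun _ => (1 : NNReal)) z : NNReal) : ℝ) ∂arcLength = 0 := by
      refine integral_eq_zero_of_ae ?_
      filter_upwards [compl_mem_ae_iff.2 hK0] with z hz
      have hz' : z ∉ K := hz
      simp [hz']
    rwa [h3] at h1
  have hle : ∀ n, μ.real K ≤ ∫ z, w n z ∂μ := fun n => by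
    rw [← integral_indicator_one hK.measurableSet]
    refine integral_mono ((integrable_const (1 : ℝ)).indicator hK.measurableSet)
      (integrable_circle _) fun z => ?_
    by_cases hz : z ∈ K
    · have hwz : w n z = 1 := congrArg NNReal.toReal (thickenedIndicator_one (hδ n) K hz)
      simp [hz, hwz]
    · simpa [hz] using (hw n z).1
  have key : μ.real K ≤ 0 := by
    refine le_of_forall_pos_le_add fun ε hε => ?_
    obtain ⟨C, hC⟩ := h ε hε
    -- With `ε` fixed, `C` is fixed too and disappears in the limit, however large it is.
    have h1 := (hlim.const_mul C).const_add ε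
    rw [mul_zero, add_zero] at h1
    rw [zero_add]
    exact ge_of_tendsto' h1 fun n => (hle n).trans (hC _ (hw n))
  have h2 := le_antisymm key measureReal_nonneg
  rwa [measureReal_eq_zero_iff] at h2

/-! ### Absolute continuity away from the zeros of `g` -/

section Evolution

variable {A : H →ₗ.[ℂ] H} {V : ℝ → unitary (H →L[ℂ] H)} {U : unitary (H →L[ℂ] H)}
  {g : C(Circle, ℝ)}

/-- The time average estimate is applied to `k = g w`, where `w` is a test function with values in
`[0, 1]`. One factor `g` comes from the commutator and the other from `k`, and together they give
the vector `g(U) φ_t` on both sides of the inner product. -/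
lemma spectralMeasure_applyReal_absolutelyContinuous_of_mem_domain (hA : IsSelfAdjoint A)
    (hV : IsUnitaryGroup A V) (hC : IsCommutator A (U : H →L[ℂ] H) (applyReal U g * U))
    {φ : H} (hφ : φ ∈ A.domain) :
    spectralMeasure U (applyReal U g φ) ≪ arcLength := by
  refine absolutelyContinuous_of_forall_integral_le fun ε hε => ?_
  let ψ : ℝ → H := fun t => applyReal U g ((V t : H →L[ℂ] H) φ)
  have hψ : Continuous ψ := (applyReal U g).continuous.comp (hV.continuous φ)
  have hψ0 : ψ 0 = applyReal U g φ := by simp [ψ, hV.map_zero]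
  have hlim : Filter.Tendsto (fun t => (‖ψ t‖ + ‖ψ 0‖) * ‖ψ t - ψ 0‖) (nhds 0) (nhds 0) := by
    have : Continuous fun t => (‖ψ t‖ + ‖ψ 0‖) * ‖ψ t - ψ 0‖ := by fun_prop
    simpa using this.tendsto 0
  obtain ⟨δ, hδ, hδ'⟩ := Metric.eventually_nhds_iff.1 (hlim.eventually (gt_mem_nhds hε))
  -- Half of `δ`, so that the closed interval `[0, T]` lies in the open ball where the variation is
  -- below `ε`.
  set T := δ / 2 with hT
  have hT0 : 0 < T := by positivity
  set M := (4 + T * ‖toComplex g‖) * ‖φ‖ ^ 2 with hM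
  -- `T⁻¹` comes from averaging over time, `M` from the time average estimate, and `‖g‖` from
  -- bounding the `L¹` norm of `g w` by that of `w`.
  refine ⟨T⁻¹ * (M * ‖g‖), fun w hw => ?_⟩
  rw [integral_spectralMeasure, ← hψ0]
  let a : ℝ → ℝ := fun t => (⟪ψ t, applyReal U w (ψ t)⟫_ℂ).re
  have ha : Continuous a := Complex.continuous_re.comp
    (hψ.inner ((applyReal U w).continuous.comp hψ))
  have h1 : ∀ t ∈ Set.Icc 0 T, a 0 - ε ≤ a t := fun t ht => by
    have h2 := abs_inner_applyReal_sub_le U hw (ψ t) (ψ 0)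
    have h3 := hδ' (y := t) (by
      rw [Real.dist_eq, sub_zero, abs_of_nonneg ht.1]
      linarith [ht.2])
    have h4 := neg_le_of_abs_le h2
    change -_ ≤ a t - a 0 at h4
    linarith
  have h2 : T * (a 0 - ε) ≤ ∫ t in (0 : ℝ)..T, a t := by
    have := intervalIntegral.integral_mono_on (μ := volume) hT0.le (intervalIntegrable_const (c := a 0 - ε))
      (ha.intervalIntegrable _ _) h1
    rwa [intervalIntegral.integral_const, sub_zero, smul_eq_mul] at this
  have h3 : ∀ t, ⟪(V t : H →L[ℂ] H) φ, funCalc U (toComplex g * toComplex (g * w))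
      ((V t : H →L[ℂ] H) φ)⟫_ℂ = ⟪ψ t, applyReal U w (ψ t)⟫_ℂ := fun t => by
    have e : toComplex g * toComplex (g * w) = toComplex (g * w * g) := by
      rw [← toComplex_mul]; congr 1; ring
    rw [e]
    change ⟪_, applyReal U (g * w * g) _⟫_ℂ = _
    rw [inner_applyReal_left, applyReal_mul, applyReal_mul]
    rfl
  have h4 := norm_integral_inner_le hA hV hC hφ hT0.le (toComplex (g * w))
  simp only [h3] at h4
  have h5 : ∫ t in (0 : ℝ)..T, a t = (∫ t in (0 : ℝ)..T, ⟪ψ t, applyReal U w (ψ t)⟫_ℂ).re := by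
    have hc : Continuous fun t => ⟪ψ t, applyReal U w (ψ t)⟫_ℂ :=
      hψ.inner ((applyReal U w).continuous.comp hψ)
    exact Complex.reCLM.intervalIntegral_comp_comm (hc.intervalIntegrable 0 T)
  have h6 : ∫ z, ‖toComplex (g * w) z‖ ∂arcLength ≤ ‖g‖ * ∫ z, w z ∂arcLength := by
    rw [← integral_const_mul]
    refine integral_mono_of_nonneg (Filter.Eventually.of_forall fun _ => norm_nonneg _)
      ((integrable_circle w).const_mul _) (Filter.Eventually.of_forall fun z => ?_)
    change ‖((g z * w z : ℝ) : ℂ)‖ ≤ ‖g‖ * w z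
    rw [Complex.norm_real, norm_mul, Real.norm_of_nonneg (hw z).1]
    have := (hw z).1
    gcongr
    exact g.norm_coe_le_norm z
  have h7 : T * (a 0 - ε) ≤ M * ‖g‖ * ∫ z, w z ∂arcLength := by
    calc _ ≤ _ := h2
      _ ≤ _ := h5 ▸ Complex.re_le_norm _
      _ ≤ _ := h4
      _ ≤ M * (‖g‖ * ∫ z, w z ∂arcLength) := by gcongr
      _ = _ := by ring
  change a 0 ≤ _
  rw [mul_assoc, ← sub_le_iff_le_add', ← div_eq_inv_mul, le_div_iff₀ hT0]
  linarith

/-- If `[A, U] U⁻¹ = g(U)`, then the spectral measures of the vectors in the range of `g(U)` are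
absolutely continuous. -/
theorem spectralMeasure_applyReal_absolutelyContinuous (hA : IsSelfAdjoint A)
    (hV : IsUnitaryGroup A V) (hC : IsCommutator A (U : H →L[ℂ] H) (applyReal U g * U))
    (φ : H) : spectralMeasure U (applyReal U g φ) ≪ arcLength := by
  refine Measure.AbsolutelyContinuous.mk fun N _ hN0 => ?_
  -- The constants above depend on `φ` through `T`, so the estimate itself is not passed to the
  -- limit. Instead the null set `N` is fixed: that `N` has measure zero for `g(U) φ` is a closed
  -- condition on `φ`, valid on the dense domain.
  have hcl : IsClosed {φ : H | applyReal U g φ ∈ spectralSubspace U Nᶜ} :=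
    (isClosed_spectralSubspace U Nᶜ).preimage (applyReal U g).continuous
  have hsub : (A.domain : Set H) ⊆ {φ : H | applyReal U g φ ∈ spectralSubspace U Nᶜ} := by
    intro φ hφ
    change spectralMeasure U (applyReal U g φ) Nᶜᶜ = 0
    rw [compl_compl]
    exact spectralMeasure_applyReal_absolutelyContinuous_of_mem_domain hA hV hC hφ hN0
  have h : φ ∈ {φ : H | applyReal U g φ ∈ spectralSubspace U Nᶜ} :=
    closure_minimal hsub hcl (hA.dense_domain φ)
  change spectralMeasure U (applyReal U g φ) Nᶜᶜ = 0 at h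
  rwa [compl_compl] at h

/-- The spectral measure of `g(U) φ` has density `g²` with respect to that of `φ`. An arc length
null set is therefore null for `φ` where `g ≠ 0`, and the zero set of `g` is null for `φ` by the
choice of the subspace. -/
theorem absolutelyContinuous_of_mem_spectralSubspace (hA : IsSelfAdjoint A)
    (hV : IsUnitaryGroup A V) (hC : IsCommutator A (U : H →L[ℂ] H) (applyReal U g * U))
    {φ : H} (hφ : φ ∈ spectralSubspace U (Set.univ \ g ⁻¹' {0})) :
    spectralMeasure U φ ≪ arcLength := by
  refine Measure.AbsolutelyContinuous.mk fun N hN hN0 => ?_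
  have h1 := spectralMeasure_applyReal_absolutelyContinuous hA hV hC φ hN0
  have hm : Measurable fun z => ((‖g z‖₊ ^ 2 : NNReal) : ENNReal) := by fun_prop
  rw [spectralMeasure_applyReal, withDensity_apply_eq_zero hm] at h1
  have h2 : spectralMeasure U φ (Set.univ \ g ⁻¹' {0})ᶜ = 0 := hφ
  refine measure_mono_null (fun z hz => ?_) (measure_union_null h1 h2)
  by_cases hg : g z = 0
  · right; simp [hg]
  · left; exact ⟨by simp [hg], hz⟩

end Evolution

/-! ### Spectral measures of a restriction -/

section Restriction

variable (U : unitary (H →L[ℂ] H)) (K : Submodule ℂ H) [CompleteSpace K]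
    (h : ∀ φ ∈ K, (U : H →L[ℂ] H) φ ∈ K) (h' : ∀ φ ∈ K, (star U : H →L[ℂ] H) φ ∈ K)

lemma coe_restrict_zpow_apply (n : ℤ) (φ : K) :
    (((restrict U K h h' ^ n : unitary (K →L[ℂ] K)) : K →L[ℂ] K) φ : H)
      = ((U ^ n : unitary (H →L[ℂ] H)) : H →L[ℂ] H) φ := by
  set R := restrict U K h h'
  have h1 : ∀ φ : K, ((R : K →L[ℂ] K) φ : H) = (U : H →L[ℂ] H) φ := fun φ => rfl
  -- Uniqueness of inverses: `U⁻¹` is applied to `R (R⁻¹ φ) = φ`, where `R` acts as `U`.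
  have h2 : ∀ φ : K, (((R⁻¹ : unitary (K →L[ℂ] K)) : K →L[ℂ] K) φ : H)
      = ((U⁻¹ : unitary (H →L[ℂ] H)) : H →L[ℂ] H) φ := fun φ => by
    have e1 : ((R * R⁻¹ : unitary (K →L[ℂ] K)) : K →L[ℂ] K) φ = φ := by
      rw [mul_inv_cancel]; rfl
    have e2 := congrArg (fun x : K => ((U⁻¹ : unitary (H →L[ℂ] H)) : H →L[ℂ] H) x) e1
    rw [← e2]
    change _ = ((U⁻¹ * U : unitary (H →L[ℂ] H)) : H →L[ℂ] H) _
    rw [inv_mul_cancel]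
    rfl
  induction n using Int.induction_on generalizing φ with
  | zero => simp
  | succ n ih =>
    rw [zpow_add_one, zpow_add_one]
    change (((R ^ (n : ℤ) : unitary (K →L[ℂ] K)) : K →L[ℂ] K) ((R : K →L[ℂ] K) φ) : H) = _
    rw [ih, h1]
    rfl
  | pred n ih =>
    rw [zpow_sub_one, zpow_sub_one]
    change (((R ^ (-(n : ℤ)) : unitary (K →L[ℂ] K)) : K →L[ℂ] K)
      (((R⁻¹ : unitary (K →L[ℂ] K)) : K →L[ℂ] K) φ) : H) = _
    rw [ih, h2]
    rfl

/-- Both calculi are continuous in `f` and agree on integer powers, hence on all continuous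
functions. The spectral measure of a vector of `K` is thus the same for `U` and for its restriction.
-/
lemma coe_funCalc_restrict_apply (f : C(Circle, ℂ)) (φ : K) :
    (funCalc (restrict U K h h') f φ : H) = funCalc U f φ := by
  refine circle_induction
    (p := fun f => (funCalc (restrict U K h h') f φ : H) = funCalc U f φ) ?_ (fun f hf => ?_) f
  · refine isClosed_eq ?_ ?_
    · exact continuous_subtype_val.comp
        ((continuous_funCalc (restrict U K h h')).clm_apply continuous_const)
    · exact (continuous_funCalc U).clm_apply continuous_const
  · induction hf using Submodule.span_induction with
    | mem f hf =>
      obtain ⟨n, rfl⟩ := hf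
      rw [funCalc_monomial, funCalc_monomial]
      exact coe_restrict_zpow_apply U K h h' n φ
    | zero => simp
    | add f₁ f₂ _ _ h₁ h₂ =>
      simp only [map_add, add_apply, Submodule.coe_add, h₁, h₂]
    | smul a f _ h₁ =>
      simp only [map_smul, smul_apply, Submodule.coe_smul, h₁]

lemma spectralMeasure_restrict (φ : K) :
    spectralMeasure (restrict U K h h') φ = spectralMeasure U (φ : H) := by
  refine measure_ext fun f => ?_
  rw [integral_spectralMeasure, integral_spectralMeasure, applyReal, applyReal,
    ← coe_funCalc_restrict_apply U K h h']
  rfl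

end Restriction

end UnitarySpectral

/-! ### The main theorem -/

theorem corollary3p4 {H : Type*} [NormedAddCommGroup H] [InnerProductSpace ℂ H] [CompleteSpace H]
    (U : unitary (H →L[ℂ] H)) (A : H →ₗ.[ℂ] H) (hA : IsSelfAdjoint A)
    (hU : UnitarySpectral.IsOfClass 1 A hA (U : H →L[ℂ] H))
    (γ : NNReal) (hγ0 : 0 < γ) (hγ1 : γ < 1)
    (g : C(Circle, ℝ)) (hg : UnitarySpectral.IsHolderClass 2 γ g)
    (hcomm : UnitarySpectral.commutator A (U : H →L[ℂ] H) * ((U⁻¹ : unitary (H →L[ℂ] H)) : H →L[ℂ] H)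
      = UnitarySpectral.applyReal U g) :
    UnitarySpectral.HasPurelyACSpectrum
      (UnitarySpectral.spectralRestriction U (Set.univ \ g ⁻¹' {0})) := by
  intro φ
  have hC := hU.isCommutator_commutator
  -- Multiplying the hypothesis by `U` on the right gives `[A, U] = g(U) U`, the form used for the
  -- powers of `U`.
  have e : UnitarySpectral.applyReal U g * (U : H →L[ℂ] H)
      = UnitarySpectral.commutator A (U : H →L[ℂ] H) := by
    rw [← hcomm, mul_assoc, ← Submonoid.coe_mul, inv_mul_cancel, OneMemClass.coe_one, mul_one]
  rw [← e] at hC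
  rw [UnitarySpectral.spectralRestriction, UnitarySpectral.spectralMeasure_restrict]
  exact UnitarySpectral.absolutelyContinuous_of_mem_spectralSubspace hA
    (UnitarySpectral.isUnitaryGroup_unitaryGroup A hA) hC φ.2
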